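/- All representations are finite-dimensional. For a finite group $G$ let $m(G)$ be the maximum degree of an irreducible representation of $G$ over $\mathbb Q$, and let $p_n$ be the number of partitions of $n$. If $\Delta$ generates $G$, the Cayley graph $(G,\Delta)$ is the automaton with state set $G$ in which each $\delta\in\Delta$ acts by $x\mapsto x\delta$. Its diameter $\operatorname{diam}_\Delta(G)$ is the least $m$ such that every element of $G$ is a product of at most $m$ elements of $\Delta$ (inverses not allowed). It is a Černý Cayley graph if, for every set $\Sigma$ of self-maps of $G$ that contains these maps and over which some word acts on $G$ as a constant map, there is such a word of length at most $(|G|-1)^2$. Then: 1. $m(S_n)\ge\sqrt{n!/p_n}$ for every $n$, and $c^n=o(m(S_n))$ as $n\to\infty$ for every real $c$. 2. If $G$ is a finite group and $H$ is a subgroup of index $2$, then $m(H)\ge m(G)/2$. Moreover $m(A_n)\ge m(S_n)/2$ for every $n$ (where $A_0$, $A_1$ are trivial), and $c^n=o(m(A_n))$ as $n\to\infty$ for every real $c$. 3. For every $n$, the set $\{(1\,2),(2\,3),\dots,(n-1\;n)\}$ generates $S_n$ with diameter $\binom n2$, and the set $\{(1\,2),(1\,2\cdots n)\}$ generates $S_n$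 with diameter at most $(n+1)n(n-1)/2$. For all sufficiently large $n$, both Cayley graphs of $S_n$ are Černý Cayley graphs. 4. Each of the following sets generates $A_n$ for every $n$, has diameter at most $Cn^k$ for constants $C,k$ that do not depend on $n$, and gives a Černý Cayley graph of $A_n$ for all sufficiently large $n$: (a) all $3$-cycles; (b) the $3$-cycles $(1\,2\,k)$, $3\le k\le n$; (c) the $3$-cycles $(k\;k{+}1\;k{+}2)$, $1\le k\le n-2$; (d) the products $(1\,2)(k\;k{+}1)$, $2\le k\le n-1$; (e) $(1\,2\,3)$ together with $(1\,2\cdots n)$ if $n$ is odd, and with $(2\,3\cdots n)$ if $n$ is even. (In 3 and 4, for small $n$, a listed permutation that needs points outside $\{1,\dots,n\}$ is omitted, and a cycle on at most one point is the identity.) 5. For all $C,k\in\mathbb N$ there is $N$ such that for all $n\ge N$ and every generating set $\Delta$ of $G=S_n$ or $G=A_n$ with $\operatorname{diam}_\Delta(G)\le Cn^k$, the Cayley graph $(G,\Delta)$ is a Černý Cayley graph. -/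

import Mathlib

/-! ### Automata and synchronizing words -/

section Automata

variable {X : Type*}

/-- The right action of a word on a state: the letters are applied one after the other,
starting with the first one. -/
def wordAct (w : List (X → X)) (x : X) : X :=
  w.foldl (fun y f => f y) x

/-- `w` is a synchronizing word of the automaton `(X, A)`, where `A` is a set of self-maps of
`X`: all its letters are in `A`, and it sends all the states to one and the same state. -/
def IsSynchronizingWord (A : Set (X → X)) (w : List (X → X)) : Prop :=
  (∀ f ∈ w, f ∈ A) ∧ ∃ c : X, ∀ x : X, wordAct w x = c

/-- An automaton is synchronizing if it admits a synchronizing word. -/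
def IsSynchronizing (A : Set (X → X)) : Prop :=
  ∃ w : List (X → X), IsSynchronizingWord A w

end Automata

/-! ### Cayley graphs -/

section Cayley

variable {G : Type*} [Group G]

/-- The Cayley graph of `G` with respect to `Δ`, as the automaton with state set `G` in which the
generators act by right multiplication. -/
def cayleyAutomaton (Δ : Set G) : Set (G → G) :=
  (fun (g : G) (x : G) => x * g) '' Δ

/-- `(G, Δ)` is a Černý Cayley graph: `Δ` generates `G`, and every synchronizing automaton with
state set `G` that contains the Cayley graph has a synchronizing word of length at most
`(|G| - 1) ^ 2`. -/
def IsCernyCayleyGraph (Δ : Set G) : Prop :=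
  Subgroup.closure Δ = ⊤ ∧
    ∀ A : Set (G → G), cayleyAutomaton Δ ⊆ A → IsSynchronizing A →
      ∃ w : List (G → G), IsSynchronizingWord A w ∧ w.length ≤ (Nat.card G - 1) ^ 2

/-- The diameter of the Cayley graph: the least `m` such that each element of `G` is the value of
a word of length at most `m` over `Δ` (positive words, no inverses). It is used only
for generating sets of finite groups, where such an `m` exists. -/
noncomputable def cayleyDiam (Δ : Set G) : ℕ :=
  sInf {m : ℕ | ∀ g : G, ∃ w : List G, (∀ x ∈ w, x ∈ Δ) ∧ w.length ≤ m ∧ w.prod = g}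

end Cayley

/-! ### Degrees of irreducible rational representations -/

section Degrees

variable (G : Type*) [Group G]

/-- The degrees of the irreducible finite-dimensional representations of `G` over `ℚ`. -/
def ratIrrepDegrees : Set ℕ :=
  {d : ℕ | ∃ (V : Type) (_ : AddCommGroup V) (_ : Module ℚ V) (ρ : Representation ℚ G V),
    FiniteDimensional ℚ V ∧ ρ.IsIrreducible ∧ Module.finrank ℚ V = d}

/-- `m(G)`: the maximum degree of an irreducible representation of `G` over `ℚ`. -/
noncomputable def maxIrrepDegree : ℕ :=
  sSup (ratIrrepDegrees G)

theorem ratIrrepDegrees_le [Finite G] {d : ℕ} (hd : d ∈ ratIrrepDegrees G) : d ≤ Nat.card G := by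
  obtain ⟨V, _, _, ρ, _, hρ, rfl⟩ := hd
  have := Fintype.ofFinite G
  obtain ⟨v, hv⟩ : ∃ v : V, v ≠ 0 := by
    by_contra! h
    apply bot_ne_top (α := Subrepresentation ρ)
    apply Subrepresentation.toSubmodule_injective
    ext x
    simp [h x]
  let S : Subrepresentation ρ :=
    { toSubmodule := Submodule.span ℚ (Set.range fun g : G => ρ g v)
      apply_mem_toSubmodule := by
        intro g x hx
        induction hx using Submodule.span_induction with
        | mem x hx =>
          obtain ⟨h, rfl⟩ := hx
          exact Submodule.subset_span ⟨g * h, by simp⟩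
        | zero => simp
        | add x y _ _ hx hy => rw [map_add]; exact Submodule.add_mem _ hx hy
        | smul a x _ hx => rw [map_smul]; exact Submodule.smul_mem _ a hx }
  have hvS : v ∈ S.toSubmodule := Submodule.subset_span ⟨1, by simp⟩
  rcases eq_bot_or_eq_top S with h | h
  · rw [h] at hvS
    exact absurd ((Submodule.mem_bot ℚ).1 hvS) hv
  · have hS : Submodule.span ℚ (Set.range fun g : G => ρ g v) = ⊤ := by
      change S.toSubmodule = ⊤
      rw [h]
      rfl
    have h1 := finrank_range_le_card (R := ℚ) (fun g : G => ρ g v)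
    rw [Set.finrank, hS, finrank_top] at h1
    rwa [Nat.card_eq_fintype_card]

theorem one_mem_ratIrrepDegrees : 1 ∈ ratIrrepDegrees G := by
  refine ⟨ℚ, inferInstance, inferInstance, Representation.trivial ℚ G ℚ, inferInstance, ?_, by simp⟩
  refine { exists_pair_ne := ⟨⊥, ⊤, ?_⟩, eq_bot_or_eq_top := ?_ }
  · intro h
    have := congrArg Subrepresentation.toSubmodule h
    exact bot_ne_top (α := Submodule ℚ ℚ) this
  · intro S
    rcases eq_bot_or_eq_top S.toSubmodule with h | h
    · exact Or.inl (Subrepresentation.toSubmodule_injective h)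
    · exact Or.inr (Subrepresentation.toSubmodule_injective h)

/-- For a finite group, `m(G)` is indeed a maximum. -/
theorem maxIrrepDegree_isGreatest [Finite G] :
    IsGreatest (ratIrrepDegrees G) (maxIrrepDegree G) := by
  have hb : BddAbove (ratIrrepDegrees G) := ⟨Nat.card G, fun _ hd => ratIrrepDegrees_le G hd⟩
  exact ⟨Nat.sSup_mem ⟨1, one_mem_ratIrrepDegrees G⟩ hb, fun _ hd => le_csSup hb hd⟩

end Degrees

/-! ### Generating sets of symmetric and alternating groups

The points `1, …, n` of the usual notation are the elements `0, …, n - 1` of `Fin n`, and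
`[a, b, c].formPerm` is the cycle `(a b c)`. -/

/-- The Coxeter–Moore generators `(1 2), (2 3), …, (n-1 n)` of `S_n`. -/
def coxeterGenerators (n : ℕ) : Set (Equiv.Perm (Fin n)) :=
  {σ | ∃ i j : Fin n, j.val = i.val + 1 ∧ σ = Equiv.swap i j}

/-- The generators `(1 2)` and `(1 2 ⋯ n)` of `S_n`. -/
def transpositionCycleGenerators (n : ℕ) : Set (Equiv.Perm (Fin n)) :=
  {σ | ∃ i j : Fin n, i.val = 0 ∧ j.val = 1 ∧ σ = Equiv.swap i j} ∪
    {(List.finRange n).formPerm}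

/-- All the 3-cycles in `A_n`. -/
def threeCycleGenerators (n : ℕ) : Set (alternatingGroup (Fin n)) :=
  {σ | (σ : Equiv.Perm (Fin n)).IsThreeCycle}

/-- The 3-cycles `(1 2 k)`, `3 ≤ k ≤ n`, in `A_n`. -/
def fixedPairThreeCycleGenerators (n : ℕ) : Set (alternatingGroup (Fin n)) :=
  {σ | ∃ i j k : Fin n, i.val = 0 ∧ j.val = 1 ∧ 2 ≤ k.val ∧
    (σ : Equiv.Perm (Fin n)) = [i, j, k].formPerm}

/-- The 3-cycles `(k k+1 k+2)`, `1 ≤ k ≤ n - 2`, in `A_n`. -/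
def consecutiveThreeCycleGenerators (n : ℕ) : Set (alternatingGroup (Fin n)) :=
  {σ | ∃ i j k : Fin n, j.val = i.val + 1 ∧ k.val = i.val + 2 ∧
    (σ : Equiv.Perm (Fin n)) = [i, j, k].formPerm}

/-- The products `(1 2)(k k+1)`, `2 ≤ k ≤ n - 1`, of two Coxeter–Moore generators, in `A_n`. -/
def mooreAlternatingGenerators (n : ℕ) : Set (alternatingGroup (Fin n)) :=
  {σ | ∃ i j k l : Fin n, i.val = 0 ∧ j.val = 1 ∧ 1 ≤ k.val ∧ l.val = k.val + 1 ∧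
    (σ : Equiv.Perm (Fin n)) = Equiv.swap i j * Equiv.swap k l}

/-- The generators `(1 2 3)` and `(1 2 ⋯ n)` (if `n` is odd) or `(1 2 3)` and `(2 3 ⋯ n)` (if `n`
is even) of `A_n`. -/
def twoAlternatingGenerators (n : ℕ) : Set (alternatingGroup (Fin n)) :=
  {σ | (∃ i j k : Fin n, i.val = 0 ∧ j.val = 1 ∧ k.val = 2 ∧
      (σ : Equiv.Perm (Fin n)) = [i, j, k].formPerm) ∨
    (Odd n ∧ (σ : Equiv.Perm (Fin n)) = (List.finRange n).formPerm) ∨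
    (Even n ∧ (σ : Equiv.Perm (Fin n)) = (List.finRange n).tail.formPerm)}

/-- The standard families of generating sets of the groups `A_n`, `n ∈ ℕ`. -/
inductive IsStandardAlternatingFamily :
    ((n : ℕ) → Set (alternatingGroup (Fin n))) → Prop
  | threeCycles : IsStandardAlternatingFamily threeCycleGenerators
  | fixedPair : IsStandardAlternatingFamily fixedPairThreeCycleGenerators
  | consecutive : IsStandardAlternatingFamily consecutiveThreeCycleGenerators
  | moore : IsStandardAlternatingFamily mooreAlternatingGenerators
  | two : IsStandardAlternatingFamily twoAlternatingGenerators

/-!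
The theorem rests on three facts.

First, a Cayley graph `(G, Δ)` whose diameter `d` is at most the degree `m` of a nontrivial
irreducible rational representation `V` of `G` is a Černý Cayley graph
(`isCernyCayleyGraph_of_cayleyDiam_le_finrank`). It suffices that each proper nonempty set `T` of
states has a larger preimage under a word of length at most `|G|`: a letter that is not injective
gives a preimage of size two, and `|G| - 2` extensions follow. Words act on functions `G → ℚ`. A
word changes the size of `T` if it moves the centred indicator function `γ` of `T` out of the space
`V₀` of functions of sum zero. Consider the spaces `W t` spanned by the images of `γ` under words of
length at most `t`, and `U t` spanned by the images under `u g v` with `|u| + |v| ≤ t` and `g ∈ G`.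
Since the automaton is synchronizing, both chains grow strictly as long as they stay in `V₀`.
As `V` is a quotient of `V₀` by an invariant subspace `K` of codimension `m`, the chain `W t` has to
leave `K` early; when it does, the invariant space generated by it maps onto `V`, and the dimension
of `U t` jumps by `m`. Hence `U t` leaves `V₀` for some `t ≤ |G| - m`
(`exists_words_sumValues_ne_zero`). Averaging over `g` turns a change of size into an increase, at a
total length of at most `|G| - m + d` (`exists_word_card_preimage_lt`).

Second, `|G| ≤ k(G) m(G) ^ 2` for a finite group with `k(G)` conjugacy classes, by the
decomposition of `ℚ[G]` into matrix algebras over division algebras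
(`card_le_card_conjClasses_mul_maxIrrepDegree_sq`); no splitting field is needed. With
`k(S_n) ≤ p_n ≤ 2 ^ n` this makes `m(S_n)` grow faster than every exponential function, and passing
to a subgroup of index two costs at most a factor of two
(`maxIrrepDegree_le_two_mul_of_index_eq_two`).

Third, the diameters are polynomial. The number of inversions gives the diameter for the
adjacent transpositions (`cayleyDiam_coxeterGenerators`). An even permutation is a product of pairs
of these, each such pair is a product of linearly many consecutive 3-cycles or their inverses
(`hasWord_mul_of_mem_coxeterGenerators`), and each of the standard families writes a consecutive
3-cycle as a word of at most linear length.
-/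

/-! ### Words acting on functions -/

section Pullback

variable {X : Type*}

theorem wordAct_append (u v : List (X → X)) (x : X) :
    wordAct (u ++ v) x = wordAct v (wordAct u x) :=
  List.foldl_append

/-- The action of words on rational functions on the states: `w` sends `γ` to `x ↦ γ (x · w)`. It
sends the indicator function of a set to that of its preimage under `w`. -/
def pullback (w : List (X → X)) : (X → ℚ) →ₗ[ℚ] (X → ℚ) :=
  LinearMap.funLeft ℚ ℚ (wordAct w)

theorem pullback_apply (w : List (X → X)) (γ : X → ℚ) (x : X) :
    pullback w γ x = γ (wordAct w x) := rfl

theorem pullback_nil (γ : X → ℚ) : pullback [] γ = γ := rfl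

variable [Fintype X]

/-- The sum of the values of a function. -/
def sumValues (X : Type*) [Fintype X] : (X → ℚ) →ₗ[ℚ] ℚ :=
  ∑ x, LinearMap.proj x

theorem sumValues_apply (γ : X → ℚ) : sumValues X γ = ∑ x, γ x := by
  simp [sumValues]

theorem finrank_ker_sumValues_add_one [Nonempty X] :
    Module.finrank ℚ (LinearMap.ker (sumValues X)) + 1 = Fintype.card X := by
  classical
  have hs : Function.Surjective (sumValues X) := by
    intro q
    obtain ⟨x⟩ := ‹Nonempty X›
    exact ⟨Pi.single x q, by simp [sumValues_apply]⟩
  have := LinearMap.finrank_range_add_finrank_ker (sumValues X)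
  rw [LinearMap.range_eq_top.2 hs, finrank_top, Module.finrank_self, Module.finrank_pi] at this
  omega

/-- A subspace of functions of sum zero is not stable under all letters if it contains a function
that some word sends to a function of nonzero sum, so every step of a chain of images grows. -/
theorem finrank_lt_of_map_letters_le {A : Set (X → X)} {γ : X → ℚ}
    (hexit : ∃ w : List (X → X), (∀ f ∈ w, f ∈ A) ∧ sumValues X (pullback w γ) ≠ 0)
    {Y Z : Submodule ℚ (X → ℚ)} (hγ : γ ∈ Y) (hY : Y ≤ LinearMap.ker (sumValues X))
    (hYZ : Y ≤ Z) (ha : ∀ a ∈ A, Y.map (LinearMap.funLeft ℚ ℚ a) ≤ Z) :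
    Module.finrank ℚ Y < Module.finrank ℚ Z := by
  by_contra! h
  obtain rfl := Submodule.eq_of_le_of_finrank_le hYZ h
  obtain ⟨w, hw, hne⟩ := hexit
  refine hne (hY ?_)
  clear hne
  induction w with
  | nil => exact hγ
  | cons a w ih =>
    exact ha a (hw a (by simp)) ⟨_, ih fun f hf => hw f (by simp [hf]), rfl⟩

theorem Submodule.finrank_map_add_finrank_inf_ker {V W : Type*} [AddCommGroup V] [Module ℚ V]
    [FiniteDimensional ℚ V] [AddCommGroup W] [Module ℚ W] (φ : V →ₗ[ℚ] W) (M : Submodule ℚ V) :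
    Module.finrank ℚ (M.map φ) + Module.finrank ℚ (M ⊓ LinearMap.ker φ : Submodule ℚ V) =
      Module.finrank ℚ M := by
  have h := LinearMap.finrank_range_add_finrank_ker (φ.domRestrict M)
  rw [LinearMap.range_domRestrict] at h
  rw [← h, ← Submodule.map_comap_subtype, add_right_inj]
  exact (Submodule.equivSubtypeMap M _).symm.finrank_eq

end Pullback

/-! ### The simple quotient of the space of functions of sum zero -/

section SimpleQuotient

variable {G : Type*} [Group G]

/-- The action of `g` on functions on `G` by right translation, `γ ↦ (x ↦ γ (x * g))`. -/
def rightTranslate (g : G) : (G → ℚ) →ₗ[ℚ] (G → ℚ) :=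
  LinearMap.funLeft ℚ ℚ (fun x => x * g)

theorem rightTranslate_apply (g : G) (γ : G → ℚ) (x : G) : rightTranslate g γ x = γ (x * g) := rfl

theorem rightTranslate_one (γ : G → ℚ) : rightTranslate 1 γ = γ := by
  ext x; simp [rightTranslate_apply]

theorem rightTranslate_mul (g h : G) (γ : G → ℚ) :
    rightTranslate (g * h) γ = rightTranslate g (rightTranslate h γ) := by
  ext x; simp [rightTranslate_apply, mul_assoc]

variable [Fintype G]

theorem sumValues_rightTranslate (g : G) (γ : G → ℚ) :
    sumValues G (rightTranslate g γ) = sumValues G γ := by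
  simp only [sumValues_apply, rightTranslate_apply]
  exact Equiv.sum_comp (Equiv.mulRight g) γ

variable {V : Type*} [AddCommGroup V] [Module ℚ V] (ρ : Representation ℚ G V)

/-- The equivariant map from functions on `G` to a representation that sends the indicator
function of the identity to `s`. -/
def orbitMap (s : V) : (G → ℚ) →ₗ[ℚ] V :=
  ∑ x : G, (LinearMap.proj x : (G → ℚ) →ₗ[ℚ] ℚ).smulRight (ρ x⁻¹ s)

theorem orbitMap_apply (s : V) (γ : G → ℚ) : orbitMap ρ s γ = ∑ x : G, γ x • ρ x⁻¹ s := by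
  simp [orbitMap]

theorem orbitMap_rightTranslate (s : V) (g : G) (γ : G → ℚ) :
    orbitMap ρ s (rightTranslate g γ) = ρ g (orbitMap ρ s γ) := by
  simp only [orbitMap_apply, rightTranslate_apply, map_sum, map_smul]
  rw [← Equiv.sum_comp (Equiv.mulRight g) fun x => γ x • ρ g (ρ x⁻¹ s)]
  refine Finset.sum_congr rfl fun x _ => ?_
  rw [← Module.End.mul_apply, ← map_mul]
  simp

variable {ρ}

theorem map_orbitMap_eq_top (hρ : ρ.IsIrreducible) (s : V) {M : Submodule ℚ (G → ℚ)}
    (hM : ∀ g, ∀ γ ∈ M, rightTranslate g γ ∈ M) (hne : ¬ M ≤ LinearMap.ker (orbitMap ρ s)) :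
    M.map (orbitMap ρ s) = ⊤ := by
  let S : Subrepresentation ρ :=
    { toSubmodule := M.map (orbitMap ρ s)
      apply_mem_toSubmodule := by
        rintro g _ ⟨γ, hγ, rfl⟩
        exact ⟨rightTranslate g γ, hM g γ hγ, orbitMap_rightTranslate ρ s g γ⟩ }
  rcases hρ.eq_bot_or_eq_top S with h | h
  · refine absurd (fun γ hγ => ?_) hne
    have : orbitMap ρ s γ ∈ S.toSubmodule := ⟨γ, hγ, rfl⟩
    rw [h] at this
    exact (Submodule.mem_bot ℚ).1 this
  · change S.toSubmodule = ⊤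
    rw [h]
    rfl

theorem not_ker_sumValues_le_ker_orbitMap {s : V} {g : G} (hs : ρ g s ≠ s) :
    ¬ LinearMap.ker (sumValues G) ≤ LinearMap.ker (orbitMap ρ s) := by
  classical
  intro h
  have h1 : (Pi.single g⁻¹ 1 - Pi.single 1 1 : G → ℚ) ∈ LinearMap.ker (sumValues G) := by
    simp [sumValues_apply]
  have h2 := LinearMap.mem_ker.1 (h h1)
  simp only [orbitMap_apply, Pi.sub_apply, sub_smul, Finset.sum_sub_distrib, Pi.single_apply,
    ite_smul, one_smul, zero_smul, Finset.sum_ite_eq', Finset.mem_univ, if_true,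
    inv_inv, inv_one, map_one, Module.End.one_apply] at h2
  exact hs (sub_eq_zero.1 h2)

/-- The dimension count behind the bound: if a word sends a function `γ` to one of
nonzero sum, then so does a composite of a word, a translation and a word, where the two words
have total length at most `|G|` minus the degree of an irreducible representation. -/
theorem exists_words_sumValues_ne_zero [FiniteDimensional ℚ V] (hρ : ρ.IsIrreducible) {s : V}
    {g : G} (hs : ρ g s ≠ s) {A : Set (G → G)} {γ : G → ℚ}
    (hexit : ∃ w : List (G → G), (∀ f ∈ w, f ∈ A) ∧ sumValues G (pullback w γ) ≠ 0) :
    ∃ (u v : List (G → G)) (h : G), (∀ f ∈ u, f ∈ A) ∧ (∀ f ∈ v, f ∈ A) ∧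
      u.length + v.length + Module.finrank ℚ V ≤ Fintype.card G ∧
      sumValues G (pullback u (rightTranslate h (pullback v γ))) ≠ 0 := by
  set m := Module.finrank ℚ V with hm
  set V₀ := LinearMap.ker (sumValues G)
  set φ := orbitMap ρ s
  have hV₀dim : Module.finrank ℚ V₀ + 1 = Fintype.card G := finrank_ker_sumValues_add_one
  have hKdim : m + Module.finrank ℚ (V₀ ⊓ LinearMap.ker φ : Submodule ℚ (G → ℚ)) =
      Module.finrank ℚ V₀ := by
    rw [← Submodule.finrank_map_add_finrank_inf_ker φ V₀,
      map_orbitMap_eq_top hρ s ?_ (not_ker_sumValues_le_ker_orbitMap hs), finrank_top]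
    intro g γ hγ
    rw [LinearMap.mem_ker, sumValues_rightTranslate]
    exact hγ
  by_contra! hcon
  let W : ℕ → Submodule ℚ (G → ℚ) := fun t => Submodule.span ℚ
    {β | ∃ v : List (G → G), (∀ f ∈ v, f ∈ A) ∧ v.length ≤ t ∧ β = pullback v γ}
  let U : ℕ → Submodule ℚ (G → ℚ) := fun t => Submodule.span ℚ
    {β | ∃ (u v : List (G → G)) (h : G), (∀ f ∈ u, f ∈ A) ∧ (∀ f ∈ v, f ∈ A) ∧
      u.length + v.length ≤ t ∧ β = pullback u (rightTranslate h (pullback v γ))}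
  have hWU : ∀ t, W t ≤ U t := fun t => Submodule.span_mono <| by
    rintro _ ⟨v, hv, hl, rfl⟩
    exact ⟨[], v, 1, by simp, hv, by simpa using hl, by rw [rightTranslate_one, pullback_nil]⟩
  have hU₀ : ∀ t, t + m ≤ Fintype.card G → U t ≤ V₀ := by
    intro t ht
    refine Submodule.span_le.2 ?_
    rintro _ ⟨u, v, h, hu, hv, hl, rfl⟩
    exact hcon u v h hu hv (by omega)
  have hγW : ∀ t, γ ∈ W t := fun t => Submodule.subset_span ⟨[], by simp, by simp, rfl⟩
  have hWgrow : ∀ t, t + m ≤ Fintype.card G →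
      Module.finrank ℚ (W t) < Module.finrank ℚ (W (t + 1)) := by
    intro t ht
    refine finrank_lt_of_map_letters_le hexit (hγW t) ((hWU t).trans (hU₀ t ht)) ?_ ?_
    · refine Submodule.span_mono ?_
      rintro _ ⟨v, hv, hl, rfl⟩
      exact ⟨v, hv, by omega, rfl⟩
    · intro a ha
      rw [Submodule.map_span_le]
      rintro _ ⟨v, hv, hl, rfl⟩
      exact Submodule.subset_span ⟨a :: v, by simpa using ⟨ha, hv⟩, by simpa using hl, rfl⟩
  have hUgrow : ∀ t, t + m ≤ Fintype.card G →
      Module.finrank ℚ (U t) < Module.finrank ℚ (U (t + 1)) := by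
    intro t ht
    refine finrank_lt_of_map_letters_le hexit (hWU t (hγW t)) (hU₀ t ht) ?_ ?_
    · refine Submodule.span_mono ?_
      rintro _ ⟨u, v, h, hu, hv, hl, rfl⟩
      exact ⟨u, v, h, hu, hv, by omega, rfl⟩
    · intro a ha
      rw [Submodule.map_span_le]
      rintro _ ⟨u, v, h, hu, hv, hl, rfl⟩
      exact Submodule.subset_span ⟨a :: u, v, h, by simpa using ⟨ha, hu⟩, hv,
        by simp only [List.length_cons]; omega, rfl⟩
  have hWdim : ∀ t, t + m ≤ Fintype.card G → t + 1 ≤ Module.finrank ℚ (W t) := by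
    intro t
    induction t with
    | zero =>
      intro _
      rw [zero_add, Submodule.one_le_finrank_iff]
      intro h0
      have := hγW 0
      rw [h0, Submodule.mem_bot] at this
      obtain ⟨w, -, hw⟩ := hexit
      simp [this] at hw
    | succ t ih =>
      intro ht
      have := hWgrow t (by omega)
      have := ih (by omega)
      omega
  -- The spaces `W t` cannot stay in the kernel of `φ`, for dimension reasons.
  have hex : ∃ t, t + m + 1 ≤ Fintype.card G ∧ ¬ W t ≤ LinearMap.ker φ := by
    refine ⟨Fintype.card G - m - 1, by omega, fun hle => ?_⟩
    have h1 := Submodule.finrank_mono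
      (le_inf ((hWU _).trans (hU₀ (Fintype.card G - m - 1) (by omega))) hle)
    have h2 := hWdim (Fintype.card G - m - 1) (by omega)
    omega
  classical
  obtain ⟨hi, hiW⟩ := Nat.find_spec hex
  have himin := fun j => Nat.find_min (m := j) hex
  set i := Nat.find hex
  let M : Submodule ℚ (G → ℚ) := Submodule.span ℚ
    {β | ∃ (v : List (G → G)) (h : G), (∀ f ∈ v, f ∈ A) ∧ v.length ≤ i ∧
      β = rightTranslate h (pullback v γ)}
  have hWM : W i ≤ M := Submodule.span_mono <| by
    rintro _ ⟨v, hv, hl, rfl⟩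
    exact ⟨v, 1, hv, hl, (rightTranslate_one _).symm⟩
  have hMU : M ≤ U i := Submodule.span_mono <| by
    rintro _ ⟨v, h, hv, hl, rfl⟩
    exact ⟨[], v, h, by simp, hv, by simpa using hl, rfl⟩
  have hMtop : M.map φ = ⊤ := by
    refine map_orbitMap_eq_top hρ s (fun h β hβ => ?_) fun h => hiW (hWM.trans h)
    have : M.map (rightTranslate h) ≤ M := by
      rw [Submodule.map_span_le]
      rintro _ ⟨v, k, hv, hl, rfl⟩
      exact Submodule.subset_span ⟨v, h * k, hv, hl, (rightTranslate_mul _ _ _).symm⟩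
    exact this ⟨β, hβ, rfl⟩
  -- `W (i - 1)` is still in the kernel, so it adds to the degree of the representation.
  have hMdim : i + m ≤ Module.finrank ℚ M := by
    rw [← Submodule.finrank_map_add_finrank_inf_ker φ M, hMtop, finrank_top, ← hm, add_comm,
      add_le_add_iff_left]
    rcases Nat.eq_zero_or_pos i with h0 | hpos
    · omega
    · have hker : W (i - 1) ≤ LinearMap.ker φ := by
        by_contra hne
        exact himin (i - 1) (by omega) ⟨by omega, hne⟩
      have hWW : W (i - 1) ≤ W i := Submodule.span_mono <| by
        rintro _ ⟨v, hv, hl, rfl⟩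
        exact ⟨v, hv, by omega, rfl⟩
      have h1 := Submodule.finrank_mono (le_inf (hWW.trans hWM) hker)
      have h2 := hWdim (i - 1) (by omega)
      omega
  have hUdim : ∀ j, i + j + m ≤ Fintype.card G → i + j + m ≤ Module.finrank ℚ (U (i + j)) := by
    intro j
    induction j with
    | zero => intro _; exact hMdim.trans (Submodule.finrank_mono hMU)
    | succ j ih =>
      intro hj
      have := hUgrow (i + j) (by omega)
      have := ih (by omega)
      rw [← add_assoc]
      omega
  have h1 := hUdim (Fintype.card G - m - i) (by omega)
  have h2 := Submodule.finrank_mono (hU₀ (i + (Fintype.card G - m - i)) (by omega))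
  omega

end SimpleQuotient

/-! ### Synchronization of automata containing a Cayley graph -/

section Synchronization

/-- The indicator function of `T`, shifted by a constant so that its values sum to zero. -/
def centredIndicator {X : Type*} [Fintype X] [DecidableEq X] (T : Finset X) (x : X) : ℚ :=
  (if x ∈ T then 1 else 0) - (T.card : ℚ) / Fintype.card X

theorem sum_centredIndicator_comp {X : Type*} [Fintype X] [DecidableEq X] [Nonempty X]
    (T : Finset X) (f : X → X) :
    ∑ x, centredIndicator T (f x) = ((Finset.univ.filter fun x => f x ∈ T).card : ℚ) - T.card := by
  have : (Fintype.card X : ℚ) ≠ 0 := by simp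
  simp only [centredIndicator, Finset.sum_sub_distrib, Finset.sum_const, Finset.card_univ,
    nsmul_eq_mul, Finset.sum_boole]
  rw [mul_div_cancel₀ _ this]

variable {G : Type*} [Group G] [Fintype G] [DecidableEq G]

theorem sum_card_preimage_translates (T : Finset G) (u v : List (G → G)) :
    ∑ h : G, (Finset.univ.filter fun x => wordAct v (wordAct u x * h) ∈ T).card =
      ∑ _h : G, (Finset.univ.filter fun x => wordAct v x ∈ T).card := by
  simp only [Finset.card_filter]
  rw [Finset.sum_comm]
  refine Finset.sum_congr rfl fun x _ => ?_
  exact Equiv.sum_comp (Equiv.mulLeft (wordAct u x)) fun y => if wordAct v y ∈ T then 1 else 0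

/-- Preimages are built up from the end of a word. If the whole word changes the size of `T`, some
letter `a` is the first to do so: the suffix `q` after it does not change the size yet. -/
theorem exists_suffix_card_preimage {X : Type*} [Fintype X] [DecidableEq X] (T : Finset X)
    (v : List (X → X)) (hv : (Finset.univ.filter fun x => wordAct v x ∈ T).card ≠ T.card) :
    ∃ (p : List (X → X)) (a : X → X) (q : List (X → X)), v = p ++ a :: q ∧
      (Finset.univ.filter fun x => wordAct q x ∈ T).card = T.card ∧
      (Finset.univ.filter fun x => wordAct q (a x) ∈ T).card ≠ T.card := by
  induction v with
  | nil => exact absurd (congrArg Finset.card (Finset.filter_univ_mem T)) hv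
  | cons a v ih =>
    by_cases h : (Finset.univ.filter fun x => wordAct v x ∈ T).card = T.card
    · exact ⟨[], a, v, rfl, h, hv⟩
    · obtain ⟨p, b, q, rfl, hq⟩ := ih h
      exact ⟨a :: p, b, q, rfl, hq⟩

variable {V : Type*} [AddCommGroup V] [Module ℚ V] [FiniteDimensional ℚ V]
  {ρ : Representation ℚ G V}

/-- A proper nonempty set of states has a larger preimage under some short word. Among the
translates inserted between two words the average size of the preimage does not change, so it
suffices that one of them changes the size. -/
theorem exists_word_card_preimage_lt (hρ : ρ.IsIrreducible) {s : V} {g : G} (hs : ρ g s ≠ s)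
    {A : Set (G → G)} (hA : IsSynchronizing A) {d : ℕ}
    (hd : ∀ h : G, ∃ l : List (G → G), (∀ f ∈ l, f ∈ A) ∧ l.length ≤ d ∧
      ∀ x, wordAct l x = x * h) {T : Finset G} (hT : T.Nonempty) (hT' : T.card < Fintype.card G) :
    ∃ w : List (G → G), (∀ f ∈ w, f ∈ A) ∧
      w.length + Module.finrank ℚ V ≤ Fintype.card G + d ∧
      T.card < (Finset.univ.filter fun x => wordAct w x ∈ T).card := by
  have hexit : ∃ w : List (G → G), (∀ f ∈ w, f ∈ A) ∧
      sumValues G (pullback w (centredIndicator T)) ≠ 0 := by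
    obtain ⟨w, hw, c, hc⟩ := hA
    refine ⟨w, hw, ?_⟩
    simp only [sumValues_apply, pullback_apply, sum_centredIndicator_comp, hc]
    rw [sub_ne_zero, Ne, Nat.cast_inj]
    have := hT.card_pos
    by_cases h : c ∈ T
    · simp only [h, Finset.filter_true, Finset.card_univ]; omega
    · simp only [h, Finset.filter_false, Finset.card_empty]; omega
  obtain ⟨u, v, h, hu, hv, hlen, hne⟩ : ∃ (u v : List (G → G)) (h : G), (∀ f ∈ u, f ∈ A) ∧
      (∀ f ∈ v, f ∈ A) ∧ u.length + v.length + Module.finrank ℚ V ≤ Fintype.card G ∧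
      (Finset.univ.filter fun x => wordAct v x ∈ T).card = T.card ∧
      (Finset.univ.filter fun x => wordAct v (wordAct u x * h) ∈ T).card ≠ T.card := by
    obtain ⟨u, v, h, hu, hv, hlen, hne⟩ := exists_words_sumValues_ne_zero hρ hs hexit
    by_cases hvT : (Finset.univ.filter fun x => wordAct v x ∈ T).card = T.card
    · refine ⟨u, v, h, hu, hv, hlen, hvT, ?_⟩
      have : sumValues G (pullback u (rightTranslate h (pullback v (centredIndicator T)))) =
        ∑ x, centredIndicator T (wordAct v (wordAct u x * h)) := sumValues_apply _
      rw [this, sum_centredIndicator_comp T fun x => wordAct v (wordAct u x * h), sub_ne_zero,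
        Ne, Nat.cast_inj] at hne
      exact hne
    · obtain ⟨p, a, q, rfl, hq, hq'⟩ := exists_suffix_card_preimage T v hvT
      refine ⟨[a], q, 1, ?_, ?_, ?_, hq, ?_⟩
      · simpa using hv a (by simp)
      · exact fun f hf => hv f (by simp [hf])
      · simp only [List.length_append, List.length_cons, List.length_nil] at hlen ⊢
        omega
      · simp only [mul_one]; exact hq'
  obtain ⟨h, hlt⟩ : ∃ h : G,
      T.card < (Finset.univ.filter fun x => wordAct v (wordAct u x * h) ∈ T).card := by
    by_contra! hle
    have h1 := sum_card_preimage_translates T u v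
    simp only [hne.1] at h1
    exact (Finset.sum_lt_sum (fun h _ => hle h)
      ⟨h, Finset.mem_univ h, lt_of_le_of_ne (hle h) hne.2⟩).ne h1
  obtain ⟨l, hl, hld, hlx⟩ := hd h
  refine ⟨u ++ (l ++ v), ?_, ?_, ?_⟩
  · intro f hf
    simp only [List.mem_append] at hf
    rcases hf with hf | hf | hf
    exacts [hu f hf, hl f hf, hv f hf]
  · simp only [List.length_append]; omega
  · simpa only [wordAct_append, hlx] using hlt

end Synchronization

section CernyCayley

variable {G : Type*} [Group G] [Finite G]

/-- In a finite group each element is a positive word over a generating set. -/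
theorem exists_word_length_le_cayleyDiam {Δ : Set G} (hΔ : Subgroup.closure Δ = ⊤) (g : G) :
    ∃ w : List G, (∀ x ∈ w, x ∈ Δ) ∧ w.length ≤ cayleyDiam Δ ∧ w.prod = g := by
  have hword : ∀ g : G, ∃ w : List G, (∀ x ∈ w, x ∈ Δ) ∧ w.prod = g := by
    intro g
    refine Submonoid.exists_list_of_mem_closure ?_
    rw [← Subgroup.closure_toSubmonoid_of_finite, hΔ]
    trivial
  choose w hw hwp using hword
  have := Fintype.ofFinite G
  have hmem : cayleyDiam Δ ∈ {m : ℕ | ∀ g : G, ∃ w : List G,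
      (∀ x ∈ w, x ∈ Δ) ∧ w.length ≤ m ∧ w.prod = g} :=
    Nat.sInf_mem ⟨Finset.univ.sup fun g => (w g).length, fun g =>
      ⟨w g, hw g, Finset.le_sup (f := fun g => (w g).length) (Finset.mem_univ g), hwp g⟩⟩
  exact hmem g

theorem wordAct_map_mul_right {G : Type*} [Group G] (l : List G) (x : G) :
    wordAct (l.map fun g x => x * g) x = x * l.prod := by
  induction l generalizing x with
  | nil => simp [wordAct]
  | cons g l ih =>
    rw [List.prod_cons, ← mul_assoc, ← ih]
    rfl

theorem exists_letter_not_injective {X : Type*} [Nontrivial X] {A : Set (X → X)}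
    (hA : IsSynchronizing A) : ∃ a ∈ A, ¬ Function.Injective a := by
  obtain ⟨w, hw, c, hc⟩ := hA
  by_contra! h
  have hinj : Function.Injective (wordAct w) := by
    clear hc
    induction w with
    | nil => exact Function.injective_id
    | cons a w ih =>
      exact (ih fun f hf => hw f (by simp [hf])).comp (h a (hw a (by simp)))
  obtain ⟨x, y, hxy⟩ := exists_pair_ne X
  exact hxy (hinj ((hc x).trans (hc y).symm))

/-- If the diameter is at most the degree of a nontrivial irreducible rational representation,
then each extension step costs at most `|G|` letters, and `1 + (|G| - 2) |G| = (|G| - 1) ^ 2`. -/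
theorem isCernyCayleyGraph_of_cayleyDiam_le_finrank {V : Type*} [AddCommGroup V] [Module ℚ V]
    [FiniteDimensional ℚ V] {ρ : Representation ℚ G V} (hρ : ρ.IsIrreducible) {s : V} {g : G}
    (hs : ρ g s ≠ s) {Δ : Set G} (hΔ : Subgroup.closure Δ = ⊤)
    (hdiam : cayleyDiam Δ ≤ Module.finrank ℚ V) : IsCernyCayleyGraph Δ := by
  classical
  refine ⟨hΔ, fun A hΔA hA => ?_⟩
  have := Fintype.ofFinite G
  have : Nontrivial G := ⟨g, 1, fun h => hs (by simp [h])⟩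
  have hcard : 1 < Fintype.card G := Fintype.one_lt_card
  have hd : ∀ h : G, ∃ l : List (G → G), (∀ f ∈ l, f ∈ A) ∧ l.length ≤ cayleyDiam Δ ∧
      ∀ x, wordAct l x = x * h := by
    intro h
    obtain ⟨w, hw, hl, rfl⟩ := exists_word_length_le_cayleyDiam hΔ h
    refine ⟨w.map fun g x => x * g, ?_, by simpa using hl, wordAct_map_mul_right w⟩
    intro f hf
    obtain ⟨d, hd, rfl⟩ := List.mem_map.1 hf
    exact hΔA ⟨d, hw d hd, rfl⟩
  obtain ⟨a, haA, ha⟩ := exists_letter_not_injective hA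
  simp only [Function.Injective, not_forall] at ha
  obtain ⟨x, y, hxy, hne⟩ := ha
  have key : ∀ k, k + 2 ≤ Fintype.card G → ∃ w : List (G → G), (∀ f ∈ w, f ∈ A) ∧
      w.length ≤ 1 + k * Fintype.card G ∧
      k + 2 ≤ (Finset.univ.filter fun z => wordAct w z ∈ ({a x} : Finset G)).card := by
    intro k
    induction k with
    | zero =>
      intro _
      refine ⟨[a], by simpa using haA, by simp, ?_⟩
      rw [zero_add, ← Finset.card_pair hne]
      refine Finset.card_le_card fun z hz => ?_
      simp only [Finset.mem_insert, Finset.mem_singleton] at hz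
      rcases hz with rfl | rfl
      · simp [wordAct]
      · simp [wordAct, hxy]
    | succ k ih =>
      intro hk
      obtain ⟨w, hw, hl, hwc⟩ := ih (by omega)
      obtain ⟨T, hT⟩ : ∃ T, T = Finset.univ.filter fun z => wordAct w z ∈ ({a x} : Finset G) :=
        ⟨_, rfl⟩
      rw [← hT] at hwc
      have hmul : (k + 1) * Fintype.card G = k * Fintype.card G + Fintype.card G := by ring
      rcases lt_or_ge (k + 2) T.card with h | h
      · exact ⟨w, hw, by omega, by rw [← hT]; omega⟩
      · obtain ⟨u, hu, hul, huc⟩ := exists_word_card_preimage_lt hρ hs hA hd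
          (Finset.card_pos.1 (by omega) : T.Nonempty) (by omega)
        refine ⟨u ++ w, ?_, ?_, ?_⟩
        · intro f hf
          rcases List.mem_append.1 hf with hf | hf
          exacts [hu f hf, hw f hf]
        · rw [List.length_append]; omega
        · have : (Finset.univ.filter fun z => wordAct u z ∈ T) =
              Finset.univ.filter fun z => wordAct (u ++ w) z ∈ ({a x} : Finset G) := by
            ext z
            simp [hT, wordAct_append]
          rw [← this]
          omega
  obtain ⟨w, hw, hl, hwc⟩ := key (Fintype.card G - 2) (by omega)
  refine ⟨w, ⟨hw, a x, fun z => ?_⟩, ?_⟩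
  · rw [Nat.sub_add_cancel hcard] at hwc
    have := Finset.mem_univ z
    rw [← Finset.eq_univ_of_card _ (le_antisymm (Finset.card_le_univ _) hwc)] at this
    simpa using this
  · rw [Nat.card_eq_fintype_card]
    obtain ⟨n, hn⟩ := Nat.exists_eq_add_of_le' hcard
    rw [hn] at hl ⊢
    have : n + Nat.succ 1 - 2 = n := by omega
    rw [this] at hl
    have : n + Nat.succ 1 - 1 = n + 1 := by omega
    rw [this]
    nlinarith

end CernyCayley

/-! ### Restriction to a subgroup of index two -/

section IndexTwo

variable {G : Type*} [Group G]

theorem nontrivial_of_isIrreducible {V : Type*} [AddCommGroup V] [Module ℚ V]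
    {ρ : Representation ℚ G V} (hρ : ρ.IsIrreducible) : Nontrivial V := by
  by_contra! h
  exact bot_ne_top (α := Subrepresentation ρ)
    (Subrepresentation.toSubmodule_injective (Subsingleton.elim _ _))

/-- A nonzero subrepresentation of least dimension is irreducible. -/
theorem exists_irreducible_subrepresentation {V : Type*} [AddCommGroup V] [Module ℚ V]
    [FiniteDimensional ℚ V] [Nontrivial V] (σ : Representation ℚ G V) :
    ∃ W : Subrepresentation σ, W.toRepresentation.IsIrreducible := by
  classical
  have hex : ∃ k, ∃ W : Subrepresentation σ, W.toSubmodule ≠ ⊥ ∧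
      Module.finrank ℚ W.toSubmodule = k := by
    refine ⟨_, ⊤, ?_, rfl⟩
    change (⊤ : Submodule ℚ V) ≠ ⊥
    exact top_ne_bot
  obtain ⟨W, hW, hWk⟩ := Nat.find_spec hex
  have hmin : ∀ S : Subrepresentation σ, S.toSubmodule ≠ ⊥ →
      Module.finrank ℚ W.toSubmodule ≤ Module.finrank ℚ S.toSubmodule := fun S hS => by
    rw [hWk]
    exact Nat.find_min' hex ⟨S, hS, rfl⟩
  refine ⟨W, { exists_pair_ne := ⟨⊥, ⊤, fun h => hW ?_⟩, eq_bot_or_eq_top := fun S => ?_ }⟩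
  · have h' : (⊥ : Submodule ℚ W.toSubmodule) = ⊤ := congrArg Subrepresentation.toSubmodule h
    rw [← Submodule.map_subtype_top W.toSubmodule, ← h', Submodule.map_bot]
  · refine or_iff_not_imp_left.2 fun hS => Subrepresentation.toSubmodule_injective ?_
    let S' : Subrepresentation σ :=
      { toSubmodule := S.toSubmodule.map W.toSubmodule.subtype
        apply_mem_toSubmodule := by
          rintro g _ ⟨v, hv, rfl⟩
          exact ⟨_, S.apply_mem_toSubmodule g hv, rfl⟩ }
    have hS' : S'.toSubmodule ≠ ⊥ := fun h => hS <| Subrepresentation.toSubmodule_injective <|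
      Submodule.map_injective_of_injective W.toSubmodule.subtype_injective
        (h.trans (Submodule.map_bot _).symm)
    have h1 := hmin S' hS'
    have h2 : Module.finrank ℚ S'.toSubmodule = Module.finrank ℚ S.toSubmodule :=
      (Submodule.equivSubtypeMap W.toSubmodule S.toSubmodule).symm.finrank_eq
    exact Submodule.eq_top_of_finrank_eq (le_antisymm (Submodule.finrank_le _) (h2 ▸ h1))

/-- If `W` is an irreducible constituent of the restriction to `H` of an irreducible
representation and `g ∉ H`, then `W + gW` is the whole space. -/
theorem maxIrrepDegree_le_two_mul_of_index_eq_two [Finite G] {H : Subgroup G} (hH : H.index = 2) :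
    maxIrrepDegree G ≤ 2 * maxIrrepDegree H := by
  obtain ⟨V, _, _, ρ, _, hρ, hdim⟩ := (maxIrrepDegree_isGreatest G).1
  have := nontrivial_of_isIrreducible hρ
  obtain ⟨W, hW⟩ := exists_irreducible_subrepresentation (ρ.comp H.subtype)
  have hWle : Module.finrank ℚ W.toSubmodule ≤ maxIrrepDegree H :=
    (maxIrrepDegree_isGreatest H).2 ⟨W.toSubmodule, _, _, _, inferInstance, hW, rfl⟩
  obtain ⟨g, hg⟩ : ∃ g, g ∉ H := by
    by_contra! h
    rw [(Subgroup.eq_top_iff' H).2 h, Subgroup.index_top] at hH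
    omega
  have hcoset : ∀ x, x ∈ H ∨ g⁻¹ * x ∈ H := by
    intro x
    rw [Subgroup.mul_mem_iff_of_index_two hH, inv_mem_iff]
    tauto
  have hmem : ∀ x, ∀ v ∈ W.toSubmodule, ρ x v ∈ W.toSubmodule ⊔ W.toSubmodule.map (ρ g) := by
    intro x v hv
    rcases hcoset x with hx | hx
    · exact Submodule.mem_sup_left (W.apply_mem_toSubmodule ⟨x, hx⟩ hv)
    · refine Submodule.mem_sup_right ⟨_, W.apply_mem_toSubmodule ⟨_, hx⟩ hv, ?_⟩
      change ρ g (ρ (g⁻¹ * x) v) = _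
      rw [← Module.End.mul_apply, ← map_mul, mul_inv_cancel_left]
  let S : Subrepresentation ρ :=
    { toSubmodule := W.toSubmodule ⊔ W.toSubmodule.map (ρ g)
      apply_mem_toSubmodule := by
        intro x v hv
        obtain ⟨a, ha, _, ⟨b, hb, rfl⟩, rfl⟩ := Submodule.mem_sup.1 hv
        rw [map_add, ← Module.End.mul_apply, ← map_mul]
        exact add_mem (hmem x a ha) (hmem _ b hb) }
  have hS : S.toSubmodule = ⊤ := by
    rcases hρ.eq_bot_or_eq_top S with h | h
    · have := nontrivial_of_isIrreducible hW
      have hWS : W.toSubmodule ≤ S.toSubmodule := le_sup_left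
      rw [h] at hWS
      exact absurd (le_bot_iff.1 hWS)
        ((Submodule.nontrivial_iff_ne_bot (p := W.toSubmodule)).1 this)
    · rw [h]; rfl
  have h1 := Submodule.finrank_add_le_finrank_add_finrank W.toSubmodule
    (W.toSubmodule.map (ρ g))
  have h2 := Submodule.finrank_map_le (ρ g) W.toSubmodule
  change Module.finrank ℚ S.toSubmodule ≤ _ at h1
  rw [hS, finrank_top, hdim] at h1
  omega

theorem maxIrrepDegree_perm_le_two_mul (n : ℕ) :
    maxIrrepDegree (Equiv.Perm (Fin n)) ≤ 2 * maxIrrepDegree (alternatingGroup (Fin n)) := by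
  have hpos := (maxIrrepDegree_isGreatest (alternatingGroup (Fin n))).2
    (one_mem_ratIrrepDegrees _)
  rcases lt_or_ge n 2 with h | h
  · have h1 := ratIrrepDegrees_le _ (maxIrrepDegree_isGreatest (Equiv.Perm (Fin n))).1
    have : Subsingleton (Fin n) := Fin.subsingleton_iff_le_one.2 (by omega)
    rw [Nat.card_of_subsingleton (1 : Equiv.Perm (Fin n))] at h1
    omega
  · have : Nontrivial (Fin n) := Fin.nontrivial_iff_two_le.2 h
    exact maxIrrepDegree_le_two_mul_of_index_eq_two alternatingGroup.index_eq_two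

end IndexTwo

/-! ### A lower bound for the maximal degree -/

section LowerBound

variable {G : Type} [Group G]

/-- The column space of a matrix algebra over a division algebra is an irreducible representation
of each group that spans the matrix algebra. -/
theorem exists_irreducible_column_representation {K D : Type*} [Field K] [DivisionRing D]
    [Algebra K D] {d : ℕ} [NeZero d]
    {f : MonoidAlgebra K G →ₐ[K] Matrix (Fin d) (Fin d) D} (hf : Function.Surjective f) :
    ∃ ρ : Representation K G (Fin d → D), ρ.IsIrreducible := by
  let τ : Matrix (Fin d) (Fin d) D →* Module.End K (Fin d → D) :=
    { toFun := fun M =>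
        { toFun := M.mulVec
          map_add' := M.mulVec_add
          map_smul' := fun c v => M.mulVec_smul c v }
      map_one' := LinearMap.ext fun v => Matrix.one_mulVec v
      map_mul' := fun M N => LinearMap.ext fun v => (Matrix.mulVec_mulVec v M N).symm }
  let ρ : Representation K G (Fin d → D) :=
    τ.comp ((f : MonoidAlgebra K G →* _).comp (MonoidAlgebra.of K G))
  refine ⟨ρ, { exists_pair_ne := ⟨⊥, ⊤, fun h => ?_⟩, eq_bot_or_eq_top := fun S => ?_ }⟩
  · exact bot_ne_top (α := Submodule K (Fin d → D)) (congrArg Subrepresentation.toSubmodule h)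
  · refine or_iff_not_imp_left.2 fun hS => Subrepresentation.toSubmodule_injective ?_
    have hstable : ∀ M : Matrix (Fin d) (Fin d) D, ∀ v ∈ S.toSubmodule,
        M.mulVec v ∈ S.toSubmodule := by
      intro M v hv
      obtain ⟨x, rfl⟩ := hf M
      induction x using MonoidAlgebra.induction_on with
      | of g => exact S.apply_mem_toSubmodule g hv
      | add x y hx hy => rw [map_add, Matrix.add_mulVec]; exact add_mem hx hy
      | smul r x hx => rw [map_smul, Matrix.smul_mulVec]; exact Submodule.smul_mem _ r hx
    obtain ⟨v, hv, hv0⟩ : ∃ v ∈ S.toSubmodule, v ≠ 0 := by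
      refine Submodule.exists_mem_ne_zero_of_ne_bot fun h => hS ?_
      exact Subrepresentation.toSubmodule_injective h
    obtain ⟨j, hj⟩ := Function.ne_iff.1 hv0
    rw [Pi.zero_apply] at hj
    refine Submodule.eq_top_iff'.2 fun u => ?_
    -- The matrix whose `j`-th column is `u`, divided by the `j`-th entry of `v`, sends `v` to `u`.
    have := hstable (Matrix.of fun i k => if k = j then u i * (v j)⁻¹ else 0) v hv
    convert this using 1
    ext i
    simp [Matrix.mulVec, dotProduct, hj, mul_assoc]

/-- An element of the group algebra that is central takes the same value on conjugate elements. -/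
theorem MonoidAlgebra.coeff_eq_of_isConj {x : MonoidAlgebra ℚ G} (hx : ∀ y, x * y = y * x)
    {g h : G} (hgh : IsConj g h) : x.coeff g = x.coeff h := by
  obtain ⟨c, rfl⟩ := isConj_iff.1 hgh
  have := congrArg (fun y : MonoidAlgebra ℚ G => y.coeff (c * g)) (hx (MonoidAlgebra.of ℚ G c))
  simpa [MonoidAlgebra.of_apply, MonoidAlgebra.coeff_mul_single_apply,
    MonoidAlgebra.coeff_single_mul_apply] using this.symm

/-- In the decomposition of the group algebra into matrix algebras `M_d(D)`, the dimension of a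
block is at most the square of the degree `d * dim D`, and there are at most as many
blocks as conjugacy classes since the central idempotents of the blocks are class functions. -/
theorem card_le_card_conjClasses_mul_maxIrrepDegree_sq [Finite G] :
    Nat.card G ≤ Nat.card (ConjClasses G) * maxIrrepDegree G ^ 2 := by
  classical
  have := Fintype.ofFinite G
  obtain ⟨n, D, d, _, _, _, hd, ⟨e⟩⟩ :=
    IsSemisimpleRing.exists_algEquiv_pi_matrix_divisionRing_finite ℚ (MonoidAlgebra ℚ G)
  have hdim : Nat.card G = ∑ i, d i * d i * Module.finrank ℚ (D i) := by
    have h := e.toLinearEquiv.finrank_eq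
    rw [Module.finrank_pi_fintype] at h
    simp only [Module.finrank_matrix, Fintype.card_fin] at h
    rw [← h]
    rw [(MonoidAlgebra.coeffLinearEquiv ℚ).finrank_eq, Module.finrank_finsupp_self,
      Nat.card_eq_fintype_card]
  have hdeg : ∀ i, d i * d i * Module.finrank ℚ (D i) ≤ maxIrrepDegree G ^ 2 := by
    intro i
    have hsurj : Function.Surjective ((Pi.evalAlgHom ℚ
        (fun i => Matrix (Fin (d i)) (Fin (d i)) (D i)) i).comp e.toAlgHom) :=
      (Function.surjective_eval i).comp e.surjective
    obtain ⟨ρ, hρ⟩ := exists_irreducible_column_representation hsurj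
    have h1 := (maxIrrepDegree_isGreatest G).2
      ⟨Fin (d i) → D i, inferInstance, inferInstance, ρ, inferInstance, hρ, rfl⟩
    rw [Module.finrank_pi_fintype, Finset.sum_const, Finset.card_univ, Fintype.card_fin,
      smul_eq_mul] at h1
    have h2 : 0 < Module.finrank ℚ (D i) := Module.finrank_pos
    calc d i * d i * Module.finrank ℚ (D i)
        ≤ d i * d i * Module.finrank ℚ (D i) * Module.finrank ℚ (D i) :=
          Nat.le_mul_of_pos_right _ h2
      _ = (d i * Module.finrank ℚ (D i)) ^ 2 := by ring
      _ ≤ maxIrrepDegree G ^ 2 := Nat.pow_le_pow_left h1 2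
  have hblocks : n ≤ Nat.card (ConjClasses G) := by
    let z : (Fin n → ℚ) →ₗ[ℚ] MonoidAlgebra ℚ G :=
      e.symm.toLinearMap ∘ₗ LinearMap.pi fun i =>
        (Algebra.linearMap ℚ (Matrix (Fin (d i)) (Fin (d i)) (D i))) ∘ₗ LinearMap.proj i
    have hz : ∀ c, z c = e.symm fun i => algebraMap ℚ _ (c i) := fun _ => rfl
    have hcentral : ∀ c y, z c * y = y * z c := by
      intro c y
      apply e.injective
      rw [map_mul, map_mul, hz, AlgEquiv.apply_symm_apply]
      ext1 i
      exact Algebra.commutes _ _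
    let T : (Fin n → ℚ) →ₗ[ℚ] (ConjClasses G → ℚ) :=
      LinearMap.pi fun C => Finsupp.lapply (Quotient.out C) ∘ₗ
        (MonoidAlgebra.coeffLinearEquiv ℚ).toLinearMap ∘ₗ z
    have hT : ∀ c C, T c C = (z c).coeff (Quotient.out C) := fun _ _ => rfl
    have hinj : Function.Injective T := by
      rw [← LinearMap.ker_eq_bot, LinearMap.ker_eq_bot']
      intro c hc
      have hz0 : z c = 0 := by
        refine MonoidAlgebra.ext (Finsupp.ext fun g => ?_)
        have h1 : IsConj g (Quotient.out (ConjClasses.mk g)) := by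
          rw [← ConjClasses.mk_eq_mk_iff_isConj]
          exact (Quotient.out_eq (ConjClasses.mk g)).symm
        exact (MonoidAlgebra.coeff_eq_of_isConj (hcentral c) h1).trans
          ((hT c (ConjClasses.mk g)).symm.trans (congrFun hc _))
      rw [hz, EmbeddingLike.map_eq_zero_iff] at hz0
      ext1 i
      exact (algebraMap ℚ (Matrix (Fin (d i)) (Fin (d i)) (D i))).injective
        ((congrFun hz0 i).trans (map_zero _).symm)
    have h := LinearMap.finrank_le_finrank_of_injective hinj
    rwa [Module.finrank_pi, Module.finrank_pi, Fintype.card_fin, ← Nat.card_eq_fintype_card] at h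
  calc Nat.card G = ∑ i, d i * d i * Module.finrank ℚ (D i) := hdim
    _ ≤ ∑ _i : Fin n, maxIrrepDegree G ^ 2 := Finset.sum_le_sum fun i _ => hdeg i
    _ = n * maxIrrepDegree G ^ 2 := by simp
    _ ≤ _ := Nat.mul_le_mul_right _ hblocks

theorem card_conjClasses_perm_le (n : ℕ) :
    Nat.card (ConjClasses (Equiv.Perm (Fin n))) ≤ Fintype.card (Nat.Partition n) := by
  have hinj : Function.Injective (fun C : ConjClasses (Equiv.Perm (Fin n)) =>
      (Quotient.out C).partition) := by
    intro C C' h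
    rw [← Equiv.Perm.partition_eq_of_isConj, ← ConjClasses.mk_eq_mk_iff_isConj] at h
    exact (Quotient.out_eq C).symm.trans (h.trans (Quotient.out_eq C'))
  have := Nat.card_le_card_of_injective _ hinj
  simpa using this

theorem factorial_le_card_partition_mul_maxIrrepDegree_sq (n : ℕ) :
    n.factorial ≤ Fintype.card (Nat.Partition n) * maxIrrepDegree (Equiv.Perm (Fin n)) ^ 2 := by
  have h := card_le_card_conjClasses_mul_maxIrrepDegree_sq (G := Equiv.Perm (Fin n))
  rw [Nat.card_perm, Nat.card_fin] at h
  exact h.trans (Nat.mul_le_mul_right _ (card_conjClasses_perm_le n))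

theorem card_partition_le (n : ℕ) : Fintype.card (Nat.Partition n) ≤ 2 ^ n :=
  (Fintype.card_le_of_surjective _ Nat.Partition.ofComposition_surj).trans
    ((composition_card n).trans_le (Nat.pow_le_pow_right two_pos (Nat.sub_le n 1)))

theorem sqrt_factorial_div_card_partition_le (n : ℕ) :
    Real.sqrt ((n.factorial : ℝ) / (Fintype.card (Nat.Partition n) : ℝ)) ≤
      (maxIrrepDegree (Equiv.Perm (Fin n)) : ℝ) := by
  have hpos : (0 : ℝ) < Fintype.card (Nat.Partition n) := by
    exact_mod_cast Fintype.card_pos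
  refine Real.sqrt_le_iff.2 ⟨Nat.cast_nonneg _, ?_⟩
  rw [div_le_iff₀ hpos, mul_comm]
  exact_mod_cast factorial_le_card_partition_mul_maxIrrepDegree_sq n

theorem pow_isLittleO_maxIrrepDegree_perm (c : ℝ) : (fun n : ℕ => c ^ n) =o[Filter.atTop]
    (fun n : ℕ => (maxIrrepDegree (Equiv.Perm (Fin n)) : ℝ)) := by
  rw [Asymptotics.isLittleO_iff]
  intro ε hε
  have h := FloorSemiring.tendsto_pow_div_factorial_atTop (2 * c ^ 2)
  filter_upwards [h.eventually_le_const (show (0 : ℝ) < ε ^ 2 by positivity)] with n hn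
  rw [div_le_iff₀ (by positivity)] at hn
  have h1 : (n.factorial : ℝ) ≤ 2 ^ n * (maxIrrepDegree (Equiv.Perm (Fin n)) : ℝ) ^ 2 := by
    exact_mod_cast (factorial_le_card_partition_mul_maxIrrepDegree_sq n).trans
      (Nat.mul_le_mul_right _ (card_partition_le n))
  rw [Real.norm_natCast, Real.norm_eq_abs]
  refine abs_le_of_sq_le_sq ?_ (by positivity)
  refine le_of_mul_le_mul_left ?_ (show (0 : ℝ) < 2 ^ n by positivity)
  calc 2 ^ n * (c ^ n) ^ 2 = (2 * c ^ 2) ^ n := by rw [mul_pow, ← pow_mul, ← pow_mul, mul_comm n 2]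
    _ ≤ ε ^ 2 * n.factorial := hn
    _ ≤ ε ^ 2 * (2 ^ n * (maxIrrepDegree (Equiv.Perm (Fin n)) : ℝ) ^ 2) := by gcongr
    _ = _ := by ring

theorem pow_isLittleO_maxIrrepDegree_alternatingGroup (c : ℝ) :
    (fun n : ℕ => c ^ n) =o[Filter.atTop]
      (fun n : ℕ => (maxIrrepDegree (alternatingGroup (Fin n)) : ℝ)) := by
  refine (pow_isLittleO_maxIrrepDegree_perm c).trans_isBigO ?_
  refine Asymptotics.IsBigO.of_bound 2 (Filter.Eventually.of_forall fun n => ?_)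
  rw [Real.norm_natCast, Real.norm_natCast]
  exact_mod_cast maxIrrepDegree_perm_le_two_mul n

end LowerBound

/-! ### Cayley graphs of small diameter -/

section SmallDiameter

variable {G : Type} [Group G] [Finite G]

theorem isCernyCayleyGraph_of_cayleyDiam_le_maxIrrepDegree (h2 : 2 ≤ maxIrrepDegree G) {Δ : Set G}
    (hΔ : Subgroup.closure Δ = ⊤) (hdiam : cayleyDiam Δ ≤ maxIrrepDegree G) :
    IsCernyCayleyGraph Δ := by
  obtain ⟨V, _, _, ρ, _, hρ, hdim⟩ := (maxIrrepDegree_isGreatest G).1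
  have := nontrivial_of_isIrreducible hρ
  obtain ⟨s, hs⟩ := exists_ne (0 : V)
  by_cases htriv : ∀ g, ρ g s = s
  · -- A fixed vector spans a subrepresentation, so the degree would be one.
    let S : Subrepresentation ρ :=
      { toSubmodule := Submodule.span ℚ {s}
        apply_mem_toSubmodule := by
          intro g v hv
          obtain ⟨c, rfl⟩ := Submodule.mem_span_singleton.1 hv
          rwa [map_smul, htriv] }
    have h1 := finrank_span_singleton (K := ℚ) hs
    change Module.finrank ℚ S.toSubmodule = 1 at h1
    rcases hρ.eq_bot_or_eq_top S with h | h
    · rw [h] at h1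
      exact absurd ((finrank_bot ℚ V).symm.trans h1) (by norm_num)
    · rw [h] at h1
      have := (finrank_top ℚ V).symm.trans h1
      omega
  · obtain ⟨g, hg⟩ := not_forall.1 htriv
    exact isCernyCayleyGraph_of_cayleyDiam_le_finrank hρ hg hΔ (hdiam.trans hdim.ge)

/-- Degrees that outgrow every exponential function outgrow every polynomial bound on the
diameter. -/
theorem eventually_isCernyCayleyGraph {H : ℕ → Type} [∀ n, Group (H n)] [∀ n, Finite (H n)]
    (hH : ∀ c : ℝ, (fun n : ℕ => c ^ n) =o[Filter.atTop]
      (fun n : ℕ => (maxIrrepDegree (H n) : ℝ))) (C k : ℕ) :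
    ∀ᶠ n : ℕ in Filter.atTop, ∀ Δ : Set (H n), Subgroup.closure Δ = ⊤ →
      cayleyDiam Δ ≤ C * n ^ k → IsCernyCayleyGraph Δ := by
  have h1 : (fun n : ℕ => (C : ℝ) * (n : ℝ) ^ k + 2) =o[Filter.atTop] fun n : ℕ => (2 : ℝ) ^ n :=
    ((isLittleO_pow_const_const_pow_of_one_lt k one_lt_two).const_mul_left _).add
      (by simpa using (isLittleO_pow_const_const_pow_of_one_lt (R := ℝ) 0
        one_lt_two).const_mul_left 2)
  filter_upwards [(h1.trans (hH 2)).bound one_pos] with n hn Δ hΔ hdiam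
  rw [one_mul, Real.norm_natCast, Real.norm_of_nonneg (by positivity)] at hn
  have hn' : C * n ^ k + 2 ≤ maxIrrepDegree (H n) := by exact_mod_cast hn
  exact isCernyCayleyGraph_of_cayleyDiam_le_maxIrrepDegree (by omega) hΔ (by omega)

end SmallDiameter

/-! ### Word lengths -/

section WordLength

variable {G : Type*} [Group G]

/-- `g` is the value of a positive word of length at most `m` over `Δ`. -/
def HasWord (Δ : Set G) (m : ℕ) (g : G) : Prop :=
  ∃ w : List G, (∀ x ∈ w, x ∈ Δ) ∧ w.length ≤ m ∧ w.prod = g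

variable {Δ Δ' : Set G} {m m' : ℕ} {g h : G}

theorem HasWord.one : HasWord Δ m 1 := ⟨[], by simp, by simp, rfl⟩

theorem HasWord.of_mem (hg : g ∈ Δ) : HasWord Δ 1 g := ⟨[g], by simpa using hg, le_rfl, by simp⟩

theorem HasWord.mono (hg : HasWord Δ m g) (hm : m ≤ m') : HasWord Δ m' g := by
  obtain ⟨w, hw, hl, hp⟩ := hg
  exact ⟨w, hw, hl.trans hm, hp⟩

theorem HasWord.mul (hg : HasWord Δ m g) (hh : HasWord Δ m' h) : HasWord Δ (m + m') (g * h) := by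
  obtain ⟨w, hw, hl, rfl⟩ := hg
  obtain ⟨u, hu, hl', rfl⟩ := hh
  refine ⟨w ++ u, fun x hx => ?_, by simpa using add_le_add hl hl', by simp⟩
  rcases List.mem_append.1 hx with hx | hx
  exacts [hw x hx, hu x hx]

theorem HasWord.pow (hg : HasWord Δ m g) (k : ℕ) : HasWord Δ (k * m) (g ^ k) := by
  induction k with
  | zero => exact pow_zero g ▸ HasWord.one
  | succ k ih => rw [pow_succ, Nat.succ_mul]; exact ih.mul hg

theorem HasWord.trans (hg : HasWord Δ' m g) (h : ∀ x ∈ Δ', HasWord Δ m' x) :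
    HasWord Δ (m * m') g := by
  obtain ⟨w, hw, hl, rfl⟩ := hg
  refine HasWord.mono ?_ (Nat.mul_le_mul_right m' hl)
  clear hl
  induction w with
  | nil => exact HasWord.one
  | cons a w ih =>
    rw [List.prod_cons, List.length_cons, Nat.succ_mul, add_comm]
    exact (h a (hw a (by simp))).mul (ih fun x hx => hw x (by simp [hx]))

theorem HasWord.mem_closure (hg : HasWord Δ m g) : g ∈ Subgroup.closure Δ := by
  obtain ⟨w, hw, -, rfl⟩ := hg
  exact list_prod_mem fun x hx => Subgroup.subset_closure (hw x hx)

theorem closure_eq_top_of_hasWord (h : ∀ g, HasWord Δ m g) : Subgroup.closure Δ = ⊤ :=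
  (Subgroup.eq_top_iff' _).2 fun g => (h g).mem_closure

theorem cayleyDiam_le_of_hasWord (h : ∀ g, HasWord Δ m g) : cayleyDiam Δ ≤ m :=
  Nat.sInf_le h

theorem HasWord.of_coe {H : Subgroup G} {T : Set H} {x : H}
    (hx : HasWord ((↑) '' T : Set G) m (x : G)) : HasWord T m x := by
  obtain ⟨w, hw, hl, hp⟩ := hx
  obtain ⟨u, hu, hul, rfl⟩ : ∃ u : List H, (∀ y ∈ u, y ∈ T) ∧ u.length = w.length ∧
      u.map (↑) = w := by
    clear hp hl
    induction w with
    | nil => exact ⟨[], by simp, rfl, rfl⟩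
    | cons a w ih =>
      obtain ⟨u, hu, hul, rfl⟩ := ih fun x hx => hw x (by simp [hx])
      obtain ⟨b, hb, rfl⟩ := hw a (by simp)
      exact ⟨b :: u, List.forall_mem_cons.2 ⟨hb, hu⟩, congrArg Nat.succ hul, rfl⟩
  refine ⟨u, hu, hul.trans_le hl, Subtype.ext ?_⟩
  rw [← hp]
  exact map_list_prod H.subtype u

end WordLength

/-! ### Inversions and the generators of the symmetric group -/

section Symmetric

open Equiv

variable {n : ℕ}

/-- The inversions of a permutation: the pairs `i < j` whose order it reverses. -/
def inversions (σ : Perm (Fin n)) : Finset (Fin n × Fin n) :=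
  Finset.univ.filter fun p => p.1 < p.2 ∧ σ p.2 < σ p.1

theorem mem_inversions {σ : Perm (Fin n)} {p : Fin n × Fin n} :
    p ∈ inversions σ ↔ p.1 < p.2 ∧ σ p.2 < σ p.1 := by
  simp [inversions]

theorem card_filter_fst_lt_snd :
    (Finset.univ.filter fun p : Fin n × Fin n => p.1 < p.2).card = n.choose 2 := by
  rw [Finset.card_filter, Fintype.sum_prod_type_right]
  have : ∀ j : Fin n, ∑ i : Fin n, (if i < j then 1 else 0) = (j : ℕ) := by
    intro j
    rw [← Finset.card_filter, Finset.filter_gt_eq_Iio, Fin.card_Iio]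
  simp only [this]
  rw [Fin.sum_univ_eq_sum_range (fun i => i), Finset.sum_range_id, Nat.choose_two_right]

theorem card_inversions_le (σ : Perm (Fin n)) : (inversions σ).card ≤ n.choose 2 := by
  rw [← card_filter_fst_lt_snd]
  exact Finset.card_le_card fun p hp => by simpa using (mem_inversions.1 hp).1

theorem card_inversions_revPerm : (inversions (Fin.revPerm : Perm (Fin n))).card = n.choose 2 := by
  rw [← card_filter_fst_lt_snd]
  congr 1
  ext p
  simp [mem_inversions]

/-- An adjacent transposition preserves the order of each pair of points but one. -/
theorem swap_lt_swap {i j a b : Fin n} (hij : j.val = i.val + 1) (hab : a < b)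
    (hne : (a, b) ≠ (i, j)) : swap i j a < swap i j b := by
  rw [Ne, Prod.mk.injEq, Fin.ext_iff, Fin.ext_iff] at hne
  simp only [swap_apply_def, Fin.ext_iff]
  rw [Fin.lt_def] at hab ⊢
  split_ifs <;> omega

theorem card_inversions_mul_swap_erase_le (σ : Perm (Fin n)) {i j : Fin n}
    (hij : j.val = i.val + 1) :
    ((inversions (σ * swap i j)).erase (i, j)).card ≤ ((inversions σ).erase (i, j)).card := by
  refine Finset.card_le_card_of_injOn (fun p => (swap i j p.1, swap i j p.2)) ?_ ?_
  · rintro ⟨a, b⟩ hp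
    obtain ⟨hne, hp⟩ := Finset.mem_erase.1 (Finset.mem_coe.1 hp)
    rw [mem_inversions] at hp
    refine Finset.mem_coe.2 (Finset.mem_erase.2 ⟨fun h => ?_, mem_inversions.2
      ⟨swap_lt_swap hij hp.1 hne, hp.2⟩⟩)
    rw [Prod.mk.injEq, swap_apply_eq_iff, swap_apply_eq_iff, swap_apply_left,
      swap_apply_right] at h
    obtain ⟨rfl, rfl⟩ := h
    have := hp.1
    simp only [Fin.lt_def] at this
    omega
  · rintro ⟨a, b⟩ _ ⟨c, d⟩ _ h
    simpa using h

theorem card_inversions_mul_swap_le (σ : Perm (Fin n)) {i j : Fin n} (hij : j.val = i.val + 1) :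
    (inversions (σ * swap i j)).card ≤ (inversions σ).card + 1 := by
  have h1 := card_inversions_mul_swap_erase_le σ hij
  have h2 := Finset.pred_card_le_card_erase (s := inversions (σ * swap i j)) (a := (i, j))
  have h3 := Finset.card_erase_le (s := inversions σ) (a := (i, j))
  omega

theorem card_inversions_mul_swap_lt {σ : Perm (Fin n)} {i j : Fin n} (hij : j.val = i.val + 1)
    (hσ : σ j < σ i) : (inversions (σ * swap i j)).card < (inversions σ).card := by
  have h1 := card_inversions_mul_swap_erase_le σ hij
  have hmem : (i, j) ∈ inversions σ := mem_inversions.2 ⟨by rw [Fin.lt_def]; simp [hij], hσ⟩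
  have hnot : (i, j) ∉ inversions (σ * swap i j) := by
    rw [mem_inversions]
    simp only [Perm.mul_apply, swap_apply_left, swap_apply_right, not_and, not_lt]
    exact fun _ => hσ.le
  rw [Finset.erase_eq_of_notMem hnot] at h1
  exact h1.trans_lt (Finset.card_erase_lt_of_mem hmem)

theorem exists_descent {σ : Perm (Fin n)} (hσ : σ ≠ 1) :
    ∃ i j : Fin n, j.val = i.val + 1 ∧ σ j < σ i := by
  by_contra! h
  apply hσ
  obtain _ | n := n
  · exact Subsingleton.elim _ _
  have hmono : StrictMono σ := by
    rw [Fin.strictMono_iff_lt_succ]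
    intro i
    refine lt_of_le_of_ne (h _ _ (by simp)) fun heq => ?_
    exact (Fin.castSucc_lt_succ (i := i)).ne (σ.injective heq)
  have : (⟨σ, hmono.le_iff_le⟩ : Fin (n + 1) ≃o Fin (n + 1)) = OrderIso.refl _ :=
    Subsingleton.elim _ _
  exact congrArg RelIso.toEquiv this

theorem hasWord_coxeterGenerators_card_inversions (σ : Perm (Fin n)) :
    HasWord (coxeterGenerators n) (inversions σ).card σ := by
  induction h : (inversions σ).card using Nat.strong_induction_on generalizing σ with
  | _ k ih =>
    by_cases hσ : σ = 1
    · exact hσ ▸ HasWord.one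
    · obtain ⟨i, j, hij, hlt⟩ := exists_descent hσ
      have hcard := card_inversions_mul_swap_lt hij hlt
      have := (ih _ (h ▸ hcard) _ rfl).mul
        (HasWord.of_mem (Δ := coxeterGenerators n) ⟨i, j, hij, rfl⟩)
      rw [mul_assoc, swap_mul_self, mul_one] at this
      exact this.mono (by omega)

theorem hasWord_coxeterGenerators (σ : Perm (Fin n)) :
    HasWord (coxeterGenerators n) (n.choose 2) σ :=
  (hasWord_coxeterGenerators_card_inversions σ).mono (card_inversions_le σ)

theorem card_inversions_list_prod_le {w : List (Perm (Fin n))}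
    (hw : ∀ x ∈ w, x ∈ coxeterGenerators n) (σ : Perm (Fin n)) :
    (inversions (σ * w.prod)).card ≤ (inversions σ).card + w.length := by
  induction w generalizing σ with
  | nil => simp
  | cons s w ih =>
    obtain ⟨i, j, hij, rfl⟩ := hw s (by simp)
    have h1 := ih (fun x hx => hw x (by simp [hx])) (σ * swap i j)
    have h2 := card_inversions_mul_swap_le σ hij
    rw [mul_assoc] at h1
    rw [List.prod_cons, List.length_cons]
    omega

theorem cayleyDiam_coxeterGenerators (n : ℕ) :
    cayleyDiam (coxeterGenerators n) = n.choose 2 := by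
  refine le_antisymm (cayleyDiam_le_of_hasWord hasWord_coxeterGenerators) ?_
  refine le_csInf ⟨_, hasWord_coxeterGenerators⟩ fun m hm => ?_
  obtain ⟨w, hw, hl, hp⟩ := hm Fin.revPerm
  have h := card_inversions_list_prod_le hw 1
  have h1 : inversions (1 : Perm (Fin n)) = ∅ := by
    ext p
    simpa [mem_inversions] using fun h => h.le
  rw [one_mul, hp, card_inversions_revPerm, h1, Finset.card_empty] at h
  omega

theorem formPerm_finRange_pow_apply {i j : Fin n} {k : ℕ} (h : j.val = i.val + k) :
    ((List.finRange n).formPerm ^ k) i = j := by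
  have := List.formPerm_pow_apply_getElem (List.finRange n) (List.nodup_finRange n) k i.val
    (by simp)
  simp only [List.getElem_finRange, List.length_finRange] at this
  refine Eq.trans this (Fin.ext ?_)
  simp [← h, Nat.mod_eq_of_lt j.isLt]

theorem formPerm_finRange_pow_card : (List.finRange n).formPerm ^ n = 1 := by
  have := List.formPerm_pow_length_eq_one_of_nodup (hl := List.nodup_finRange n)
  rwa [List.length_finRange] at this

/-- In a group where `c ^ n = 1`, conjugation by `c ^ k` costs `n` letters. -/
theorem HasWord.conj_pow {G : Type*} [Group G] {Δ : Set G} {m n k : ℕ} {c g : G} (hc : c ∈ Δ)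
    (hcn : c ^ n = 1) (hk : k ≤ n) (hg : HasWord Δ m g) :
    HasWord Δ (n + m) (c ^ k * g * (c ^ k)⁻¹) := by
  have hinv : (c ^ k)⁻¹ = c ^ (n - k) := by
    rw [inv_eq_iff_mul_eq_one, ← pow_add, Nat.add_sub_cancel' hk, hcn]
  rw [hinv]
  exact ((((HasWord.of_mem hc).pow k).mul hg).mul ((HasWord.of_mem hc).pow (n - k))).mono (by omega)

theorem hasWord_transpositionCycleGenerators (σ : Perm (Fin n)) :
    HasWord (transpositionCycleGenerators n) (n.choose 2 * (n + 1)) σ := by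
  refine (hasWord_coxeterGenerators σ).trans ?_
  rintro _ ⟨i, j, hij, rfl⟩
  have hi := i.isLt
  have hj := j.isLt
  have hmem : swap (⟨0, by omega⟩ : Fin n) ⟨1, by omega⟩ ∈ transpositionCycleGenerators n :=
    Or.inl ⟨_, _, rfl, rfl, rfl⟩
  have hc : (List.finRange n).formPerm ∈ transpositionCycleGenerators n := Or.inr rfl
  have h := (HasWord.of_mem hmem).conj_pow (k := i) hc formPerm_finRange_pow_card hi.le
  rw [← swap_apply_apply, formPerm_finRange_pow_apply (j := i) (by simp),
    formPerm_finRange_pow_apply (j := j) (by simp; omega)] at h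
  exact h

theorem cayleyDiam_transpositionCycleGenerators_le (n : ℕ) :
    cayleyDiam (transpositionCycleGenerators n) ≤ n.choose 2 * (n + 1) :=
  cayleyDiam_le_of_hasWord hasWord_transpositionCycleGenerators

end Symmetric

/-! ### Generators of the alternating group -/

section Alternating

open Equiv

variable {n : ℕ}

theorem formPerm_triple_inv {α : Type*} [DecidableEq α] {a b c : α} (h : [a, b, c].Nodup) :
    [a, b, c].formPerm⁻¹ = [a, b, c].formPerm ^ 2 := by
  have := List.formPerm_pow_length_eq_one_of_nodup (hl := h)
  rw [inv_eq_iff_mul_eq_one, ← pow_succ']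
  exact this

theorem formPerm_triple {α : Type*} [DecidableEq α] (a b c : α) :
    [a, b, c].formPerm = swap a b * swap b c := by
  simp

theorem conj_formPerm_triple {α : Type*} [DecidableEq α] (σ : Perm α) (a b c : α) :
    σ * [a, b, c].formPerm * σ⁻¹ = [σ a, σ b, σ c].formPerm := by
  simp only [formPerm_triple, swap_apply_apply]
  group

theorem HasWord.formPerm_triple_inv {S : Set (Perm (Fin n))} {m : ℕ} {a b c : Fin n}
    (hg : HasWord S m [a, b, c].formPerm) (h : [a, b, c].Nodup) :
    HasWord S (2 * m) [a, b, c].formPerm⁻¹ :=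
  (_root_.formPerm_triple_inv h).symm ▸ hg.pow 2

/-- If the consecutive 3-cycles are words of length at most `L`, then so are the products of two
adjacent transpositions, up to a factor linear in `n`: with `s_k = (k k+1)`, the product `s_0 s_k`
telescopes as `(s_0 s_1)(s_1 s_2) ⋯ (s_{k-1} s_k)`. -/
theorem hasWord_mul_of_mem_coxeterGenerators {S : Set (Perm (Fin n))} {L : ℕ}
    (hS : ∀ i j k : Fin n, j.val = i.val + 1 → k.val = i.val + 2 →
      HasWord S L [i, j, k].formPerm) {s t : Perm (Fin n)} (hs : s ∈ coxeterGenerators n)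
    (ht : t ∈ coxeterGenerators n) : HasWord S (4 * n * L) (s * t) := by
  obtain ⟨i, j, hij, rfl⟩ := hs
  obtain ⟨k, l, hkl, rfl⟩ := ht
  have key : ∀ (q : ℕ) (hq : q + 1 < n),
      HasWord S (q * (2 * L)) (swap ⟨0, by omega⟩ ⟨1, by omega⟩ *
        swap (⟨q, by omega⟩ : Fin n) ⟨q + 1, hq⟩) ∧
      HasWord S (q * (2 * L)) (swap ⟨q, by omega⟩ ⟨q + 1, hq⟩ *
        swap (⟨0, by omega⟩ : Fin n) ⟨1, by omega⟩) := by
    intro q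
    induction q with
    | zero =>
      intro hq
      simp only [zero_add, swap_mul_self]
      exact ⟨HasWord.one, HasWord.one⟩
    | succ q ih =>
      intro hq
      obtain ⟨h1, h2⟩ := ih (by omega)
      have h3 := hS ⟨q, by omega⟩ ⟨q + 1, by omega⟩ ⟨q + 2, hq⟩ rfl rfl
      have h4 := h3.formPerm_triple_inv (by simp)
      rw [formPerm_triple, mul_inv_rev, swap_inv, swap_inv] at h4
      rw [formPerm_triple] at h3
      have h13 := h1.mul h3
      have h42 := h4.mul h2
      rw [mul_assoc, swap_mul_self_mul] at h13 h42
      exact ⟨h13.mono (by linarith), h42.mono (by linarith)⟩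
  have hi := (key i (hij ▸ j.isLt)).2
  have hk := (key k (hkl ▸ l.isLt)).1
  have h := hi.mul hk
  rw [mul_assoc, swap_mul_self_mul] at h
  have hj : (⟨i.val + 1, hij ▸ j.isLt⟩ : Fin n) = j := Fin.ext hij.symm
  have hl : (⟨k.val + 1, hkl ▸ l.isLt⟩ : Fin n) = l := Fin.ext hkl.symm
  rw [hj, hl] at h
  refine h.mono ?_
  have h1 : i.val * (2 * L) ≤ n * (2 * L) := Nat.mul_le_mul_right _ i.isLt.le
  have h2 : k.val * (2 * L) ≤ n * (2 * L) := Nat.mul_le_mul_right _ k.isLt.le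
  linarith

/-- An even permutation is a product of an even number of adjacent transpositions, hence of pairs
of them. -/
theorem hasWord_of_mem_alternatingGroup {S : Set (Perm (Fin n))} {L : ℕ}
    (hS : ∀ s ∈ coxeterGenerators n, ∀ t ∈ coxeterGenerators n, HasWord S L (s * t))
    {σ : Perm (Fin n)} (hσ : σ ∈ alternatingGroup (Fin n)) : HasWord S (n.choose 2 * L) σ := by
  obtain ⟨w, hw, hl, rfl⟩ := hasWord_coxeterGenerators σ
  have hsign : ∀ w : List (Perm (Fin n)), (∀ x ∈ w, x ∈ coxeterGenerators n) →
      Perm.sign w.prod = (-1) ^ w.length := by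
    intro w hw
    induction w with
    | nil => simp
    | cons s w ih =>
      obtain ⟨i, j, hij, rfl⟩ := hw s (by simp)
      have hne : i ≠ j := fun h => by rw [h] at hij; omega
      rw [List.prod_cons, Perm.sign_mul, Perm.sign_swap hne, ih fun x hx => hw x (by simp [hx]),
        List.length_cons, pow_succ']
  have hpair : ∀ (k : ℕ) (w : List (Perm (Fin n))), (∀ x ∈ w, x ∈ coxeterGenerators n) →
      w.length = k + k → HasWord S (k * L) w.prod := by
    intro k
    induction k with
    | zero =>
      intro w _ hwk
      rw [List.length_eq_zero_iff.1 hwk]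
      exact HasWord.one
    | succ k ih =>
      rintro (_ | ⟨s, _ | ⟨t, w⟩⟩) hw hwk
      · simp at hwk
      · simp only [List.length_cons, List.length_nil] at hwk; omega
      · simp only [List.length_cons] at hwk
        have h := (hS s (hw s (by simp)) t (hw t (by simp))).mul
          (ih w (fun x hx => hw x (by simp [hx])) (by omega))
        rw [List.prod_cons, List.prod_cons, ← mul_assoc]
        exact h.mono (by linarith)
  rw [Perm.mem_alternatingGroup, hsign w hw] at hσ
  obtain ⟨k, hk⟩ := (neg_one_pow_eq_one_iff_even (by decide)).1 hσ
  exact (hpair k w hw hk).mono (Nat.mul_le_mul_right _ (by omega))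

theorem formPerm_triple_mem_alternatingGroup {a b c : Fin n} (h : [a, b, c].Nodup) :
    [a, b, c].formPerm ∈ alternatingGroup (Fin n) := by
  simp only [List.nodup_cons, List.mem_cons, not_or, List.not_mem_nil] at h
  rw [Perm.mem_alternatingGroup, formPerm_triple, Perm.sign_mul, Perm.sign_swap h.1.1,
    Perm.sign_swap h.2.1.1]
  rfl

theorem nodup_triple_of_val_lt {i j k : Fin n} (hij : i.val < j.val) (hjk : j.val < k.val) :
    [i, j, k].Nodup := by
  simp [Fin.ext_iff]
  omega

theorem hasWord_of_formPerm_triple_mem {T : Set (alternatingGroup (Fin n))} {a b c : Fin n}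
    (h : [a, b, c].Nodup) (hT : ⟨_, formPerm_triple_mem_alternatingGroup h⟩ ∈ T) :
    HasWord ((↑) '' T : Set (Perm (Fin n))) 1 [a, b, c].formPerm :=
  HasWord.of_mem ⟨_, hT, rfl⟩

theorem hasWord_threeCycle_threeCycleGenerators {i j k : Fin n} (hj : j.val = i.val + 1)
    (hk : k.val = i.val + 2) :
    HasWord ((↑) '' threeCycleGenerators n : Set (Perm (Fin n))) 1 [i, j, k].formPerm := by
  have hnd := nodup_triple_of_val_lt (i := i) (j := j) (k := k) (by omega) (by omega)
  refine hasWord_of_formPerm_triple_mem hnd ?_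
  change ([i, j, k].formPerm).IsThreeCycle
  simp only [List.nodup_cons, List.mem_cons, not_or, List.not_mem_nil] at hnd
  rw [formPerm_triple, swap_comm]
  exact Perm.isThreeCycle_swap_mul_swap_same (Ne.symm hnd.1.1) hnd.2.1.1 hnd.1.2.1

theorem hasWord_threeCycle_consecutive {i j k : Fin n} (hj : j.val = i.val + 1)
    (hk : k.val = i.val + 2) :
    HasWord ((↑) '' consecutiveThreeCycleGenerators n : Set (Perm (Fin n))) 1
      [i, j, k].formPerm :=
  hasWord_of_formPerm_triple_mem (nodup_triple_of_val_lt (by omega) (by omega))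
    ⟨i, j, k, hj, hk, rfl⟩

/-- With `s_k = (k k+1)` and `t_k = s_0 s_k`, the consecutive 3-cycle `s_k s_{k+1}` is
`t_k⁻¹ t_{k+1}`; here `t_0 = 1`, `t_1` is a 3-cycle, and `t_k` is an involution otherwise. -/
theorem hasWord_threeCycle_of_swap_mul_swap {S : Set (Perm (Fin n))}
    (hS : ∀ z o k l : Fin n, z.val = 0 → o.val = 1 → 1 ≤ k.val → l.val = k.val + 1 →
      swap z o * swap k l ∈ S) {i j k : Fin n}
    (hj : j.val = i.val + 1) (hk : k.val = i.val + 2) : HasWord S 3 [i, j, k].formPerm := by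
  have hkn := k.isLt
  obtain ⟨z, hz⟩ : ∃ z : Fin n, z.val = 0 := ⟨⟨0, by omega⟩, rfl⟩
  obtain ⟨o, ho⟩ : ∃ o : Fin n, o.val = 1 := ⟨⟨1, by omega⟩, rfl⟩
  have h2 := HasWord.of_mem (hS z o j k hz ho (by omega) (by omega))
  rw [formPerm_triple]
  rcases Nat.lt_trichotomy i.val 1 with h0 | h1 | h1
  · obtain rfl : i = z := Fin.ext (by omega)
    obtain rfl : j = o := Fin.ext (by omega)
    exact h2.mono (by omega)
  · obtain rfl : i = o := Fin.ext (by omega)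
    have h3 := HasWord.of_mem (hS z i i j hz ho (by omega) (by omega))
    rw [← formPerm_triple] at h3
    have h4 := (h3.formPerm_triple_inv (nodup_triple_of_val_lt (by omega) (by omega))).mul h2
    rwa [formPerm_triple, mul_inv_rev, swap_inv, swap_inv, mul_assoc, swap_mul_self_mul] at h4
  · have h3 := HasWord.of_mem (hS z o i j hz ho (by omega) (by omega))
    have hcomm : swap z o * swap i j = swap i j * swap z o := by
      refine (Perm.Disjoint.commute ?_).eq
      refine Perm.disjoint_swap_swap ?_
      simp [Fin.ext_iff]
      omega
    rw [hcomm] at h3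
    have h4 := h3.mul h2
    rw [mul_assoc, swap_mul_self_mul] at h4
    exact h4.mono (by omega)

theorem swap_mul_swap_mem_alternatingGroup {a b c d : Fin n} (hab : a ≠ b) (hcd : c ≠ d) :
    swap a b * swap c d ∈ alternatingGroup (Fin n) := by
  rw [Perm.mem_alternatingGroup, Perm.sign_mul, Perm.sign_swap hab, Perm.sign_swap hcd]
  rfl

theorem hasWord_threeCycle_moore {i j k : Fin n} (hj : j.val = i.val + 1)
    (hk : k.val = i.val + 2) :
    HasWord ((↑) '' mooreAlternatingGenerators n : Set (Perm (Fin n))) 3 [i, j, k].formPerm := by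
  refine hasWord_threeCycle_of_swap_mul_swap (fun z o k l hz ho hk hl => ?_) hj hk
  exact ⟨⟨_, swap_mul_swap_mem_alternatingGroup (fun h => by rw [h] at hz; omega)
    (fun h => by rw [h] at hl; omega)⟩, ⟨z, o, k, l, hz, ho, hk, hl, rfl⟩, rfl⟩

theorem swap_mul_swap_eq_formPerm_mul {α : Type*} [DecidableEq α] {a b c d : α}
    (h : [a, b, c, d].Nodup) :
    swap a b * swap c d =
      [a, b, c].formPerm * [a, b, d].formPerm * [a, b, d].formPerm * [a, b, c].formPerm := by
  simp only [formPerm_triple]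
  ext x
  simp only [Perm.mul_apply, swap_apply_def]
  grind

theorem hasWord_threeCycle_fixedPair {i j k : Fin n} (hj : j.val = i.val + 1)
    (hk : k.val = i.val + 2) :
    HasWord ((↑) '' fixedPairThreeCycleGenerators n : Set (Perm (Fin n))) 12
      [i, j, k].formPerm := by
  refine HasWord.trans (m := 3) (m' := 4) (hasWord_threeCycle_of_swap_mul_swap
    (S := {σ | ∃ z o k l : Fin n, z.val = 0 ∧
    o.val = 1 ∧ 1 ≤ k.val ∧ l.val = k.val + 1 ∧ σ = swap z o * swap k l})
    (fun z o k l hz ho hk hl => ⟨z, o, k, l, hz, ho, hk, hl, rfl⟩) hj hk) ?_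
  rintro _ ⟨z, o, k, l, hz, ho, hk, hl, rfl⟩
  have hgen : ∀ q : Fin n, 2 ≤ q.val → HasWord ((↑) '' fixedPairThreeCycleGenerators n :
      Set (Perm (Fin n))) 1 [z, o, q].formPerm := fun q hq =>
    hasWord_of_formPerm_triple_mem (nodup_triple_of_val_lt (by omega) (by omega))
      ⟨z, o, q, hz, ho, hq, rfl⟩
  rcases hk.eq_or_lt with hk | hk
  · obtain rfl : o = k := Fin.ext (by omega)
    rw [← formPerm_triple]
    exact (hgen l (by omega)).mono (by omega)
  · have hnd : [z, o, k, l].Nodup := by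
      simp [Fin.ext_iff]
      omega
    rw [swap_mul_swap_eq_formPerm_mul hnd]
    exact (((hgen k hk).mul (hgen l (by omega))).mul (hgen l (by omega))).mul (hgen k hk)

theorem formPerm_triple_eq_mul {α : Type*} [DecidableEq α] {z a b c : α}
    (h : [z, a, b, c].Nodup) :
    [a, b, c].formPerm = [z, b, c].formPerm * [z, a, b].formPerm ^ 2 * [z, b, c].formPerm ^ 2 := by
  simp only [formPerm_triple, pow_two]
  ext x
  simp only [Perm.mul_apply, swap_apply_def]
  grind

/-- For `n = N + 1` the list is `1, …, N`, so its points move up by one, the last one excepted. -/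
theorem formPerm_finRange_tail_pow_apply {i j : Fin n} {k : ℕ} (hi : 1 ≤ i.val)
    (h : j.val = i.val + k) : ((List.finRange n).tail.formPerm ^ k) i = j := by
  have hj := j.isLt
  have hlen : (List.finRange n).tail.length = n - 1 := by simp
  have := List.formPerm_pow_apply_getElem (List.finRange n).tail
    ((List.nodup_finRange n).tail) k (i.val - 1) (by omega)
  simp only [List.getElem_tail, List.getElem_finRange, hlen] at this
  have hmod : (i.val - 1 + k) % (n - 1) = j.val - 1 := by
    rw [Nat.mod_eq_of_lt (by omega)]
    omega
  convert this using 1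
  · congr 1
    ext
    simp
    omega
  · ext
    simp [hmod]
    omega

theorem formPerm_finRange_tail_pow_card : (List.finRange n).tail.formPerm ^ (n - 1) = 1 := by
  have := List.formPerm_pow_length_eq_one_of_nodup (hl := (List.nodup_finRange n).tail)
  rwa [List.length_tail, List.length_finRange] at this

theorem formPerm_finRange_tail_apply_of_val_eq_zero {i : Fin n} (hi : i.val = 0) (k : ℕ) :
    ((List.finRange n).tail.formPerm ^ k) i = i := by
  refine Perm.pow_apply_eq_self_of_apply_eq_self (List.formPerm_apply_of_notMem ?_) k
  obtain _ | n := n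
  · exact i.elim0
  · obtain rfl : i = 0 := Fin.ext hi
    simp [List.finRange_succ, Fin.succ_ne_zero]

theorem formPerm_mem_alternatingGroup_of_odd_length {l : List (Fin n)} (hl : l.Nodup)
    (hodd : Odd l.length) : l.formPerm ∈ alternatingGroup (Fin n) := by
  -- The order of the permutation divides an odd number, so its sign is 1.
  obtain ⟨k, hk⟩ := hodd
  have hpow : l.formPerm ^ l.length = 1 :=
    List.formPerm_pow_length_eq_one_of_nodup (hl := hl)
  have hsign := congrArg Perm.sign hpow
  rw [hk, pow_succ, pow_mul, map_mul, map_pow, map_pow, Int.units_sq, one_pow, one_mul,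
    map_one] at hsign
  exact Perm.mem_alternatingGroup.2 hsign

theorem hasWord_threeCycle_twoAlternating {i j k : Fin n} (hj : j.val = i.val + 1)
    (hk : k.val = i.val + 2) :
    HasWord ((↑) '' twoAlternatingGenerators n : Set (Perm (Fin n))) (5 * (n + 1))
      [i, j, k].formPerm := by
  have hkn := k.isLt
  obtain ⟨z, hz⟩ : ∃ z : Fin n, z.val = 0 := ⟨⟨0, by omega⟩, rfl⟩
  obtain ⟨o, ho⟩ : ∃ o : Fin n, o.val = 1 := ⟨⟨1, by omega⟩, rfl⟩
  obtain ⟨t, ht⟩ : ∃ t : Fin n, t.val = 2 := ⟨⟨2, by omega⟩, rfl⟩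
  have h0 : HasWord ((↑) '' twoAlternatingGenerators n : Set (Perm (Fin n))) 1
      [z, o, t].formPerm :=
    hasWord_of_formPerm_triple_mem (nodup_triple_of_val_lt (by omega) (by omega))
      (Or.inl ⟨z, o, t, hz, ho, ht, rfl⟩)
  rcases Nat.even_or_odd n with hn | hn
  · have hmem : (List.finRange n).tail.formPerm ∈
        ((↑) '' twoAlternatingGenerators n : Set (Perm (Fin n))) := by
      refine ⟨⟨_, formPerm_mem_alternatingGroup_of_odd_length (List.nodup_finRange n).tail ?_⟩,
        Or.inr (Or.inr ⟨hn, rfl⟩), rfl⟩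
      rw [List.length_tail, List.length_finRange]
      exact Nat.Even.sub_odd (by omega) hn odd_one
    -- Conjugates of `(1 2 3)` by powers of `(2 3 ⋯ n)`.
    have hgen : ∀ a b : Fin n, 1 ≤ a.val → b.val = a.val + 1 →
        HasWord ((↑) '' twoAlternatingGenerators n : Set (Perm (Fin n))) (n + 1)
          [z, a, b].formPerm := by
      intro a b ha hb
      have hbn := b.isLt
      have h := h0.conj_pow (k := a.val - 1) hmem formPerm_finRange_tail_pow_card (by omega)
      rw [conj_formPerm_triple, formPerm_finRange_tail_apply_of_val_eq_zero hz,
        formPerm_finRange_tail_pow_apply (j := a) (by omega) (by omega),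
        formPerm_finRange_tail_pow_apply (j := b) (by omega) (by omega)] at h
      exact h.mono (by omega)
    rcases Nat.eq_zero_or_pos i.val with hi | hi
    · obtain rfl : i = z := Fin.ext (by omega)
      exact (hgen j k (by omega) (by omega)).mono (by omega)
    · have hnd : [z, i, j, k].Nodup := by
        simp [Fin.ext_iff]
        omega
      rw [formPerm_triple_eq_mul hnd]
      exact (((hgen j k (by omega) (by omega)).mul ((hgen i j hi hj).pow 2)).mul
        ((hgen j k (by omega) (by omega)).pow 2)).mono (by omega)
  · have hmem : (List.finRange n).formPerm ∈
        ((↑) '' twoAlternatingGenerators n : Set (Perm (Fin n))) := by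
      refine ⟨⟨_, formPerm_mem_alternatingGroup_of_odd_length (List.nodup_finRange n) ?_⟩,
        Or.inr (Or.inl ⟨hn, rfl⟩), rfl⟩
      rwa [List.length_finRange]
    have h := h0.conj_pow (k := i.val) hmem formPerm_finRange_pow_card (by omega)
    rw [conj_formPerm_triple, formPerm_finRange_pow_apply (j := i) (by omega),
      formPerm_finRange_pow_apply (j := j) (by omega),
      formPerm_finRange_pow_apply (j := k) (by omega)] at h
    exact h.mono (by omega)

theorem hasWord_threeCycle_of_isStandardAlternatingFamily
    {Δ : (n : ℕ) → Set (alternatingGroup (Fin n))} (hΔ : IsStandardAlternatingFamily Δ) {n : ℕ}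
    {i j k : Fin n} (hj : j.val = i.val + 1) (hk : k.val = i.val + 2) :
    HasWord ((↑) '' Δ n : Set (Perm (Fin n))) (12 * (n + 1)) [i, j, k].formPerm := by
  cases hΔ with
  | threeCycles => exact (hasWord_threeCycle_threeCycleGenerators hj hk).mono (by omega)
  | fixedPair => exact (hasWord_threeCycle_fixedPair hj hk).mono (by omega)
  | consecutive => exact (hasWord_threeCycle_consecutive hj hk).mono (by omega)
  | moore => exact (hasWord_threeCycle_moore hj hk).mono (by omega)
  | two => exact (hasWord_threeCycle_twoAlternating hj hk).mono (by omega)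

theorem hasWord_of_isStandardAlternatingFamily
    {Δ : (n : ℕ) → Set (alternatingGroup (Fin n))} (hΔ : IsStandardAlternatingFamily Δ) {n : ℕ}
    (g : alternatingGroup (Fin n)) : HasWord (Δ n) (96 * n ^ 4) g := by
  have h := hasWord_of_mem_alternatingGroup (fun s hs t ht =>
    hasWord_mul_of_mem_coxeterGenerators (fun i j k hj hk =>
      hasWord_threeCycle_of_isStandardAlternatingFamily hΔ hj hk) hs ht) g.2
  refine h.of_coe.mono ?_
  have h1 : n.choose 2 ≤ n ^ 2 := Nat.choose_le_pow n 2
  rcases Nat.eq_zero_or_pos n with rfl | hn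
  · simp
  · calc n.choose 2 * (4 * n * (12 * (n + 1)))
        ≤ n ^ 2 * (4 * n * (12 * (n + n))) := by gcongr; omega
      _ = 96 * n ^ 4 := by ring

end Alternating

/-! ### The growth of degrees and the Černý bound for symmetric and alternating groups -/

theorem mainTheorem8 :
    -- `m(S_n) ≥ √(n! / p_n)`
    (∀ n : ℕ, Real.sqrt ((n.factorial : ℝ) / (Fintype.card (Nat.Partition n) : ℝ)) ≤
      (maxIrrepDegree (Equiv.Perm (Fin n)) : ℝ)) ∧
    -- `m(S_n)` grows faster than any exponential function
    (∀ c : ℝ, (fun n : ℕ => c ^ n) =o[Filter.atTop]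
      (fun n : ℕ => (maxIrrepDegree (Equiv.Perm (Fin n)) : ℝ))) ∧
    -- `m(H) ≥ m(G) / 2` for a subgroup `H` of index 2
    (∀ (G : Type*) [Group G] [Finite G] (H : Subgroup G), H.index = 2 →
      (maxIrrepDegree G : ℝ) / 2 ≤ (maxIrrepDegree H : ℝ)) ∧
    -- `m(A_n) ≥ m(S_n) / 2`, and `m(A_n)` grows faster than any exponential function
    (∀ n : ℕ, (maxIrrepDegree (Equiv.Perm (Fin n)) : ℝ) / 2 ≤
      (maxIrrepDegree (alternatingGroup (Fin n)) : ℝ)) ∧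
    (∀ c : ℝ, (fun n : ℕ => c ^ n) =o[Filter.atTop]
      (fun n : ℕ => (maxIrrepDegree (alternatingGroup (Fin n)) : ℝ))) ∧
    -- the Coxeter generators of `S_n`
    ((∀ n : ℕ, Subgroup.closure (coxeterGenerators n) = ⊤ ∧
        cayleyDiam (coxeterGenerators n) = n.choose 2) ∧
      ∀ᶠ n : ℕ in Filter.atTop, IsCernyCayleyGraph (coxeterGenerators n)) ∧
    -- the generators `(1 2)`, `(1 2 ⋯ n)` of `S_n`
    ((∀ n : ℕ, Subgroup.closure (transpositionCycleGenerators n) = ⊤ ∧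
        (cayleyDiam (transpositionCycleGenerators n) : ℝ) ≤
          ((n : ℝ) + 1) * (n : ℝ) * ((n : ℝ) - 1) / 2) ∧
      ∀ᶠ n : ℕ in Filter.atTop, IsCernyCayleyGraph (transpositionCycleGenerators n)) ∧
    -- the standard generating sets of `A_n`
    (∀ Δ : (n : ℕ) → Set (alternatingGroup (Fin n)), IsStandardAlternatingFamily Δ →
      (∀ n : ℕ, Subgroup.closure (Δ n) = ⊤) ∧
      (∃ C k : ℕ, ∀ n : ℕ, cayleyDiam (Δ n) ≤ C * n ^ k) ∧
      ∀ᶠ n : ℕ in Filter.atTop, IsCernyCayleyGraph (Δ n)) ∧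
    -- all the generating sets of `S_n` and of `A_n` of polynomially bounded diameter
    (∀ C k : ℕ, ∀ᶠ n : ℕ in Filter.atTop,
      (∀ Δ : Set (Equiv.Perm (Fin n)), Subgroup.closure Δ = ⊤ →
        cayleyDiam Δ ≤ C * n ^ k → IsCernyCayleyGraph Δ) ∧
      (∀ Δ : Set (alternatingGroup (Fin n)), Subgroup.closure Δ = ⊤ →
        cayleyDiam Δ ≤ C * n ^ k → IsCernyCayleyGraph Δ)) := by
  have hS := eventually_isCernyCayleyGraph (H := fun n => Equiv.Perm (Fin n))
    pow_isLittleO_maxIrrepDegree_perm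
  have hA := eventually_isCernyCayleyGraph (H := fun n => alternatingGroup (Fin n))
    pow_isLittleO_maxIrrepDegree_alternatingGroup
  refine ⟨sqrt_factorial_div_card_partition_le, pow_isLittleO_maxIrrepDegree_perm, ?_, ?_,
    pow_isLittleO_maxIrrepDegree_alternatingGroup, ⟨fun n => ⟨?_, ?_⟩, ?_⟩,
    ⟨fun n => ⟨?_, ?_⟩, ?_⟩, fun Δ hΔ => ⟨fun n => ?_, ⟨96, 4, fun n => ?_⟩, ?_⟩,
    fun C k => (hS C k).and (hA C k)⟩
  · intro G _ _ H hH
    rw [div_le_iff₀ two_pos, mul_comm]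
    exact_mod_cast maxIrrepDegree_le_two_mul_of_index_eq_two hH
  · intro n
    rw [div_le_iff₀ two_pos, mul_comm]
    exact_mod_cast maxIrrepDegree_perm_le_two_mul n
  · exact closure_eq_top_of_hasWord hasWord_coxeterGenerators
  · exact cayleyDiam_coxeterGenerators n
  · filter_upwards [hS 1 2] with n hn
    refine hn _ (closure_eq_top_of_hasWord hasWord_coxeterGenerators) ?_
    rw [cayleyDiam_coxeterGenerators, one_mul]
    exact Nat.choose_le_pow n 2
  · exact closure_eq_top_of_hasWord hasWord_transpositionCycleGenerators
  · have h : (cayleyDiam (transpositionCycleGenerators n) : ℝ) ≤ (n.choose 2 : ℝ) * (n + 1) := by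
      exact_mod_cast cayleyDiam_transpositionCycleGenerators_le n
    rw [Nat.cast_choose_two] at h
    exact h.trans_eq (by ring)
  · filter_upwards [hS 2 3, Filter.eventually_ge_atTop 1] with n hn hn1
    refine hn _ (closure_eq_top_of_hasWord hasWord_transpositionCycleGenerators) ?_
    calc cayleyDiam (transpositionCycleGenerators n) ≤ n.choose 2 * (n + 1) :=
          cayleyDiam_transpositionCycleGenerators_le n
      _ ≤ n ^ 2 * (n + n) := Nat.mul_le_mul (Nat.choose_le_pow n 2) (by omega)
      _ = 2 * n ^ 3 := by ring
  · exact closure_eq_top_of_hasWord (hasWord_of_isStandardAlternatingFamily hΔ)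
  · exact cayleyDiam_le_of_hasWord (hasWord_of_isStandardAlternatingFamily hΔ)
  · filter_upwards [hA 96 4] with n hn
    exact hn _ (closure_eq_top_of_hasWord (hasWord_of_isStandardAlternatingFamily hΔ))
      (cayleyDiam_le_of_hasWord (hasWord_of_isStandardAlternatingFamily hΔ))
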